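/- **Types and signatures.** Fix identifiers (used for variables and for contract names; `balance` is one of them) and let addresses be natural numbers. An integer type $\iota$ is $\mathtt{uint}_M$ or $\mathtt{int}_M$ with $M\in\{8,16,\dots,256\}$, with the usual range, or the unbounded type $\mathtt{int}$; write $n\in\iota$ if $n$ is in the range of $\iota$ (always, if $\iota$ is unbounded). Base types $\beta$ are the $\iota$, $\mathtt{bool}$ and $\mathtt{address}$; mapping types are $\mu ::= \beta \mid \mathtt{mapping}(\beta\Rightarrow\mu)$; ABI types are $\alpha ::= \beta \mid \mathtt{address}_A$; slot types are $\sigma ::= \mu\mid\alpha\mid A$, with $A$ a contract name. An interface $I=(x_i:\alpha_i)_i$ and a storage typing $C=(x_i:\sigma_i)_i$ are read as partial functions (the first entry for $x$ counts). A *signature* $\Sigma$ consists of partial functions on contract names: $\Sigma_{Storage}(A)$ is a storage typing, $\Sigma_{Cnstr}(A)$ a constructor, $\Sigma_{Trans}(A)$ a finite list of transitions. $\Sigma'\subset\Sigma$ means that all three components of $\Sigma'$ are restrictions of those of $\Sigma$ and $\Sigma'\ne\Sigma$. **Syntax.** - References: $r ::= x\mid \mathtt{pre}(x)\mid\mathtt{post}(x)\mid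 r\ \mathtt{as}\ A\mid r.x\mid r[e]\mid\mathtt{caller}\mid\mathtt{origin}\mid\mathtt{callvalue}\mid\mathtt{this}$. - Base expressions $e$: integer and boolean literals, $r$ (annotated with an ABI type), $\mathtt{addr}(r)$ (annotated with a contract name), $e_1\circ e_2$ with $\circ\in\{+,-,*,/,\%,\wedge\}$ ($\wedge$ is power) or a boolean connective (and, or, $\Rightarrow$) or a comparison $<,\le,\ge,>$, $\neg e$, $\mathtt{inrange}(\iota,e)$, $\mathtt{if}\ e_1\ \mathtt{then}\ e_2\ \mathtt{else}\ e_3$, $e_1=e_2$. - Mapping expressions: $m ::= e\mid [e_i\Rightarrow m_i]_i\mid r[e_i\Rightarrow m_i]_i$, the last two annotated with a mapping type. - Slot expressions: $se ::= m\mid r\ (\text{annotated with a contract name})\mid\mathtt{addr}(se)\mid\mathtt{new}\,A(se_1,\dots,se_n)\mid\mathtt{new}\,A\{\mathtt{value}: se\}(se_1,\dots,se_n)$. - A create is $\sigma\,x:=se$; an update is $r:=se$, with $r$ annotated with a slot type. - A constructor has an interface, a payability flag, boolean preconditions (iffs), postconditions, and finitely many cases, each a condition with a list of creates. A transition has an interface,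 a payability flag, an optional return type, iffs, postconditions, and finitely many cases, each a condition with a list of updates and an optional return expression. **Values, states, environments.** Base values are integers, booleans and addresses; values are base values, and functions from integers, booleans or addresses to values. A state $s$ is a partial function from addresses to pairs of a contract name and a store (a partial function from identifiers to values); $s(\ell)(x)$ is the value stored for $x$ at $\ell$. An environment $\rho$ is a partial function from identifiers and the three keywords $\mathtt{caller},\mathtt{origin},\mathtt{callvalue}$ (which are not identifiers) to base values. **Evaluation** (at a location $\ell$, in a state $s$ or, for *timed* references and base expressions, a pair $(s,s')$ of pre- and post-state). - References. Keywords are looked up in $\rho$, and $\mathtt{this}$ is $\ell$. In a single state, $x$ is $\rho(x)$ if $x\in\mathrm{dom}\,\rho$, and otherwise $s(\ell)(x)$. In a pair, $x$ is $\rho(x)$, with time "pre"; if $x\notin\mathrm{dom}\,\rho$, then $\mathtt{pre}(x)$ is $s(\ell)(x)$ with time "pre" and $\mathtt{post}(x)$ is $s'(\ell)(x)$ with time "post". $r\ \mathtt{as}\ A$ is $r$. $r.x$ evaluates $r$ to an address and reads $x$ there, in $s$, or in a pair in $s$ or $s'$ according to the time of $r$. $r[e]$ is function application. The time of $r$ is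 inherited by $r\ \mathtt{as}\ A$, $r.x$ and $r[e]$; keywords have no time. - Base expressions have the evident meaning: $\mathtt{addr}(r)$ evaluates as $r$; $\mathtt{inrange}(\iota,e)$ is the truth value of $n\in\iota$ for the value $n$ of $e$; division and remainder by $0$ give $0$; a power with negative exponent is undefined. - Mappings. $[e_i\Rightarrow m_i]_i$ evaluates to the function that takes the value of $m_i$ at the value of $e_i$ and the default value of the value type ($0$, false, address $0$, or the constant function) elsewhere; $r[e_i\Rightarrow m_i]_i$ overrides the value of $r$ in the same way. The first matching key counts. - Slot expressions evaluate to a value and a new state. Mapping expressions and references do not change the state, and $\mathtt{addr}(se)$ evaluates as $se$. $\mathtt{new}\,A(se_1,\dots,se_n)$, where the constructor $\Sigma_{Cnstr}(A)$ is not payable and has parameters $x_1,\dots,x_n$, evaluates $se_1,\dots,se_n$ in turn, threading the state, to base values $v_i$, and then runs the cases of the constructor in the resulting state and the environment $\{x_i\mapsto v_i\}\cup\{\mathtt{caller}\mapsto\ell,\ \mathtt{origin}\mapsto\rho(\mathtt{origin}),\ \mathtt{callvalue}\mapsto 0\}$; its value is the new location. $\mathtt{new}\,A\{\mathtt{value}:se\}(\dots)$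 is the same for a payable constructor, with $se$ evaluated after the arguments and $\mathtt{callvalue}$ bound to its value. - A list of creates for $A$ evaluates its right-hand sides in turn, threading the state, and then puts an instance of $A$ with the resulting store at $\ell=\max(\mathrm{dom}\ s)+1$, where $s$ is the state so reached and $\max\emptyset=0$. The cases of a constructor evaluate if exactly one condition evaluates to true and all others to false, and then run the creates of that case. Everything that belongs directly to a constructor (iffs, conditions, right-hand sides of creates) is evaluated at a fixed placeholder address $d$ (arbitrary, but the same throughout). - A list of updates evaluates all right-hand sides in turn, threading the state, and then writes the values in order; writing to $x$ (to $r.x$) changes the already existing entry $x$ in the store of $\ell$ (of the address that $r$ evaluates to in the current state). The cases of a transition evaluate as those of a constructor; the return expression of the chosen case is evaluated in the pair of the initial and the final state. - A constructor (transition) evaluates if all its iffs are true in the initial state and its cases evaluate. **Typing of values.** $n:\iota$ iff $n\in\iota$; a boolean has type $\mathtt{bool}$ and an address has type $\mathtt{address}$; a function has type $\mathtt{mapping}(\beta\Rightarrow\mu)$ iff its arguments are of the sort of $\beta$ and it sends all arguments of type $\beta$ to values of type $\mu$. Inductively, $\Sigma\vdash\ell:_s\mathtt{address}_A$ holds if $s(\ell)$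 is an instance of $A$, $\Sigma_{Storage}(A)=C$ is defined, the store at $\ell$ has the same domain as $C$, and $\Sigma\vdash s(\ell)(x):_s C(x)$ for every $x$ in it; and $\Sigma\vdash\ell:_s A$ holds iff $\Sigma\vdash\ell:_s\mathtt{address}_A$. $\Sigma\vdash\rho:_s I$ means that the identifiers in $\mathrm{dom}\,\rho$ are those of $I$, that $\Sigma\vdash\rho(x):_s I(x)$ for each of them, and that $\rho(\mathtt{caller}),\rho(\mathtt{origin})$ are addresses and $\rho(\mathtt{callvalue})$ is a $\mathtt{uint}_{256}$. **Entailment.** Let $\hat A$ be a contract name or absent. A configuration $(s,\rho,\ell)$ is well-typed for $\Sigma,I,\hat A$ if $\Sigma\vdash\rho:_s I$ and, if $\hat A=A$ is present, $\Sigma\vdash\ell:_s A$. $\Sigma;I;\Phi\vDash_{\hat A}e$ means that $e$ evaluates to true in all well-typed configurations in which $\Phi$ does. $\Sigma;I;\Phi\vDash_{\hat A}(se_1,\dots,se_n;\ x_1,\dots,x_n;\ P)$, for a list $P$ of expressions, means: whenever $\Phi$ evaluates to true in a well-typed configuration and $se_1,\dots,se_n$ evaluate there in turn, threading the state, to base values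 $v_1,\dots,v_n$, all members of $P$ evaluate to true at $d$ in the final state and the environment $\{x_i\mapsto v_i\}$ (without keywords). **Typing of expressions** (relative to $\Sigma,I,\hat A$, an expression $\Phi$, and a mode, timed or untimed). - References carry a tag, $S$ (storage) or $N$ (other). A variable $x$ of $I$ has type $I(x)$, tag $N$. If $\hat A=A$ and $x$ is not in $I$, then $x$ in untimed mode, and $\mathtt{pre}(x),\mathtt{post}(x)$ in timed mode, have type $\Sigma_{Storage}(A)(x)$, tag $S$. If $r:\mathtt{address}_A$, then $(r\ \mathtt{as}\ A):A$ and $r:\mathtt{address}$, tag $N$. If $r:A$, then $r.x:\Sigma_{Storage}(A)(x)$, with the tag of $r$. If $r:\mathtt{mapping}(\beta\Rightarrow\mu)$ and $e:\beta$ (with $\Phi=\mathtt{true}$), then $r[e]:\mu$, tag $N$. In untimed mode, with tag $N$, $\mathtt{caller},\mathtt{origin}:\mathtt{address}$, $\mathtt{callvalue}:\mathtt{uint}_{256}$, and $\mathtt{this}:\mathtt{address}_A$ if $\hat A=A$. - Base expressions. A literal $n$ has any type $\iota$ with $n\in\iota$; boolean literals have type $\mathtt{bool}$. A reference of type $\beta$,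 annotated $\beta$, has type $\beta$. $\mathtt{addr}(r):\mathtt{address}$ if $r:A$, annotated $A$, in untimed mode. If $e_1,e_2$ have integer types, $e_1\circ e_2$ has type $\iota$ for an arithmetic operator $\circ$ provided $\Sigma;I;\Phi\vDash_{\hat A}\mathtt{inrange}(\iota,e_1\circ e_2)$ in untimed mode, or provided $\iota$ is unbounded in timed mode. An expression of an integer type also has every integer type $\iota$ that is unbounded or satisfies $\Sigma;I;\Phi\vDash_{\hat A}\mathtt{inrange}(\iota,e)$. Boolean connectives take booleans to $\mathtt{bool}$; comparisons take two expressions of the same integer type, and $=$ two of the same base type, to $\mathtt{bool}$; $\mathtt{inrange}(\iota,e):\mathtt{bool}$ for $e$ of integer type; both branches of a conditional have its type, and its condition is boolean. - Mapping expressions (untimed). An expression of type $\beta$ has mapping type $\beta$. $[e_i\Rightarrow m_i]_i$ annotated $\mathtt{mapping}(\beta\Rightarrow\mu)$ has that type if all $e_i:\beta$, $m_i:\mu$; likewise $r[e_i\Rightarrow m_i]_i$, if also $r$ has that type. - Slot expressions (untimed). $m:\mu$ as a slot expression if as a mapping expression; $r:A$ if $r$ is a reference of type $A$, annotated $A$;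 $\mathtt{addr}(se):\mathtt{address}_A$ if $se:A$; $\mathtt{new}\,A(se_1,\dots,se_n):A$ if $\Sigma_{Cnstr}(A)$ is a constructor that is not payable, with interface $(x_i:\alpha_i)_{i\le n}$ and iffs $P$, $se_i:\alpha_i$ for all $i$, and $\Sigma;I;\Phi\vDash_{\hat A}(se_1,\dots,se_n;x_1,\dots,x_n;P)$; $\mathtt{new}\,A\{\mathtt{value}:se\}(\dots):A$ if the same holds for a payable constructor and $se:\mathtt{uint}_{256}$. **Typing of constructors and transitions.** An interface is well-formed in $\Sigma$ if each type $\mathtt{address}_A$ in it has $A\in\mathrm{dom}\,\Sigma_{Storage}$. A slot type is well-formed if it is a mapping type, or $\mathtt{address}_A$ or $A$ with $A\in\mathrm{dom}\,\Sigma_{Storage}$. $\Sigma\vdash_A c:C$, for a constructor $c$ with well-formed interface $I$ and iffs $P$, means: the iffs and the case conditions are boolean (untimed, $\Phi=\mathtt{true}$, $\hat A$ absent); for each case with condition $e$, the slot types in its creates $(\sigma_i\,x_i:=se_i)_i$ are well-formed, $C=(x_i:\sigma_i)_i$, $C(\mathtt{balance})=\mathtt{uint}_{256}$, and $se_i:\sigma_i$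 for all $i$ with $\Phi=e\ \text{and}\ \bigwedge P$ and $\hat A$ absent; $C$ and $I$ have no common variable; the postconditions are boolean (untimed) in $\Sigma$ extended by $\Sigma_{Storage}(A):=C$, with $\hat A=A$; and $\bigwedge P\Rightarrow$ "at least one, and no two, of the case conditions hold" is entailed ($\Phi=\mathtt{true}$, $\hat A$ absent). $\Sigma\vdash_A t$, for a transition $t$ with well-formed interface $I$ and iffs $P$, means, with $\hat A=A$ throughout: the iffs and the case conditions are boolean (untimed, $\Phi=\mathtt{true}$); for each case with condition $e$ and updates $(r_i:=se_i)_i$, each $r_i$ has its annotated type $\sigma_i$ with tag $S$, untimed, and $se_i:\sigma_i$ with $\Phi=e\ \text{and}\ \bigwedge P$, and for $j<i$ the reference $r_j$ is neither equal to $r_i$ nor of the form $r_i.y_1.\cdots.y_k$ with $k\ge 1$; each case has a return expression iff a return type is declared, and then the return type is a base type and the expression has that type in timed mode ($\Phi=\mathtt{true}$); the postconditions are boolean in timed mode; and $\bigwedge P\Rightarrow$ "at least one, and no two, of the case conditions hold" is entailed ($\Phi=\mathtt{true}$). **Well-typed signatures** form the least class such that $\Sigma$ is well-typed if 1. every $A\in\mathrm{dom}\,\Sigma_{Storage}$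 is in $\mathrm{dom}\,\Sigma_{Cnstr}$; 2. for every $A\in\mathrm{dom}\,\Sigma_{Cnstr}$ there is a well-typed $\Sigma'\subset\Sigma$ with $\Sigma'\vdash_A\Sigma_{Cnstr}(A):\Sigma_{Storage}(A)$ (in particular $\Sigma_{Storage}(A)$ is defined); 3. for every $A\in\mathrm{dom}\,\Sigma_{Trans}$ there is a well-typed $\Sigma'\subset\Sigma$ with $\Sigma'\vdash_A t$ for all $t$ in $\Sigma_{Trans}(A)$. **Steps.** A constructor step leads from $s$ to $s'$ if for some $A\in\mathrm{dom}\,\Sigma_{Cnstr}$ and some $\rho$ that is well-typed in $s$ for the interface of $\Sigma_{Cnstr}(A)$, that constructor evaluates from $s$ and $\rho$ to $s'$, creating an instance of $A$. A transition step leads from $s$ to $s'$ if for some $A$, some $\ell$ with $\Sigma\vdash\ell:_s A$, some transition $t$ in $\Sigma_{Trans}(A)$ and some $\rho$ that is well-typed in $s$ for the interface of $t$, $t$ evaluates at $\ell$ from $s$ and $\rho$ to $s'$. A state is *possible* if it is reached from the empty state by finitely many steps. **Lemma (reachable store is well-typed).** Let $\Sigma$ be a well-typed signature. For every possible state $s$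 and every $\ell\in\mathrm{dom}\,s$ there is a contract name $A$ with $\Sigma\vdash\ell:_s A$. -/

import Mathlib

namespace Act

/-! ## Identifiers, types -/

/-- Identifiers, both of variables (lower case) and of contracts (upper case). -/
abbrev Ident := String

/-- The storage variable called balance, spelled by code points. -/
def balanceName : Ident :=
  String.ofList ([98, 97, 108, 97, 110, 99, 101].map Char.ofNat)

abbrev Addr := ℕ

/-- Integer types. The index `k` stands for the width `M = 8 * (k + 1)`, so `M` runs through
`8, 16, ..., 256`; `unbounded` is the type of mathematical integers. -/
inductive IntTy where
  | uint (k : Fin 32)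
  | sint (k : Fin 32)
  | unbounded

/-- `ι.Mem n` : `min ι ≤ n ≤ max ι`, or `ι` is unbounded. -/
def IntTy.Mem : IntTy → ℤ → Prop
  | .uint k, n => 0 ≤ n ∧ n ≤ 2 ^ (8 * (k.val + 1)) - 1
  | .sint k, n => -2 ^ (8 * (k.val + 1) - 1) ≤ n ∧ n ≤ 2 ^ (8 * (k.val + 1) - 1) - 1
  | .unbounded, _ => True

/-- Base types. -/
inductive BaseTy where
  | int (ι : IntTy)
  | bool
  | address

def BaseTy.uint256 : BaseTy := .int (.uint 31)

/-- Mapping types; every base type is one. -/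
inductive MapTy where
  | base (β : BaseTy)
  | mapping (β : BaseTy) (μ : MapTy)

/-- ABI types; every base type is one. -/
inductive ABITy where
  | base (β : BaseTy)
  | addressOf (A : Ident)

/-- Slot types: mapping types, ABI types and contracts. A base type occurs once, as a mapping
type; `ABITy.toSlot` identifies it with the corresponding ABI type. -/
inductive SlotTy where
  | map (μ : MapTy)
  | addressOf (A : Ident)
  | contract (A : Ident)

def BaseTy.toSlot (β : BaseTy) : SlotTy := .map (.base β)

def ABITy.toSlot : ABITy → SlotTy
  | .base β => β.toSlot
  | .addressOf A => .addressOf A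

/-! ## Values, states, environments -/

/-- The three sorts of base values. -/
inductive Kind where
  | int
  | bool
  | addr

@[reducible] def Kind.Carrier : Kind → Type
  | .int => ℤ
  | .bool => Bool
  | .addr => Addr

instance Kind.decEqCarrier : (X : Kind) → DecidableEq X.Carrier
  | .int => inferInstanceAs (DecidableEq ℤ)
  | .bool => inferInstanceAs (DecidableEq Bool)
  | .addr => inferInstanceAs (DecidableEq ℕ)

inductive BaseValue where
  | int (n : ℤ)
  | bool (b : Bool)
  | addr (ℓ : Addr)

def Kind.inj : (X : Kind) → X.Carrier → BaseValue
  | .int, n => .int n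
  | .bool, b => .bool b
  | .addr, ℓ => .addr ℓ

/-- Values: base values, and functions to values on the integers, booleans or addresses. -/
inductive Value where
  | base (b : BaseValue)
  | fn (X : Kind) (f : X.Carrier → Value)

/-- The sort of the values of a base type. -/
def BaseTy.kind : BaseTy → Kind
  | .int _ => .int
  | .bool => .bool
  | .address => .addr

/-- The default value of a mapping type. -/
def MapTy.default : MapTy → Value
  | .base (.int _) => .base (.int 0)
  | .base .bool => .base (.bool false)
  | .base .address => .base (.addr 0)
  | .mapping β μ => .fn β.kind (fun _ => μ.default)

def vTrue : Value := .base (.bool true)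

def vFalse : Value := .base (.bool false)

/-- What a state holds at a location: the contract name and the storage. -/
structure Obj where
  type : Ident
  store : Ident → Option Value

/-- States: partial functions from addresses to contract instances. -/
abbrev State := Addr → Option Obj

def State.empty : State := fun _ => none

def State.dom (s : State) : Set Addr := {ℓ | (s ℓ).isSome}

/-- The value `s(ℓ)(x)`, if defined. -/
def State.read (s : State) (ℓ : Addr) (x : Ident) : Option Value :=
  (s ℓ).bind (fun o => o.store x)

/-- The keys of an environment: variables, and the three keywords, which are not variables. -/
inductive EnvKey where
  | var (x : Ident)
  | caller
  | origin
  | callvalue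

/-- Environments: partial functions from keys to base values. -/
abbrev Env := EnvKey → Option BaseValue

/-- `{xᵢ ↦ vᵢ}`, with no entry for the keywords. -/
def bindArgs (xs : List Ident) (bs : List BaseValue) : Env
  | .var x => (xs.zip bs).lookup x
  | _ => none

/-- `{xᵢ ↦ vᵢ} ∪ {caller ↦ c, origin ↦ o, callvalue ↦ w}`. -/
def callEnv (xs : List Ident) (bs : List BaseValue) (c o w : BaseValue) : Env
  | .var x => (xs.zip bs).lookup x
  | .caller => some c
  | .origin => some o
  | .callvalue => some w

/-! ## Syntax -/

inductive IntOp where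
  | add | sub | mul | div | mod | exp

inductive BoolOp where
  | and | or | imp

inductive CmpOp where
  | lt | le | ge | gt

/-- Keywords that refer to the calling environment. -/
inductive EnvRef where
  | caller | origin | callvalue | this

mutual
/-- Variable references. -/
inductive Ref where
  | var (x : Ident)
  | pre (x : Ident)
  | post (x : Ident)
  | coerce (r : Ref) (A : Ident)
  | field (r : Ref) (y : Ident)
  | index (r : Ref) (e : Exp)
  | env (k : EnvRef)
/-- Base expressions; references carry a type annotation. -/
inductive Exp where
  | int (n : ℤ)
  | bool (b : Bool)
  | ref (r : Ref) (ann : ABITy)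
  | addr (r : Ref) (ann : Ident)
  | bopI (op : IntOp) (e₁ e₂ : Exp)
  | bopB (op : BoolOp) (e₁ e₂ : Exp)
  | cmp (op : CmpOp) (e₁ e₂ : Exp)
  | neg (e : Exp)
  | inrange (ι : IntTy) (e : Exp)
  | ite (e₁ e₂ e₃ : Exp)
  | eq (e₁ e₂ : Exp)
end

/-- Mapping expressions: base expressions, `[eᵢ ⇒ mᵢ]` and `ref[eᵢ ⇒ mᵢ]`, annotated with a
mapping type. -/
inductive MapExp where
  | exp (e : Exp)
  | lit (n : ℕ) (keys : Fin n → Exp) (vals : Fin n → MapExp) (ann : MapTy)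
  | upd (r : Ref) (n : ℕ) (keys : Fin n → Exp) (vals : Fin n → MapExp) (ann : MapTy)

/-- Slot expressions. -/
inductive SlotExp where
  | map (m : MapExp)
  | new (A : Ident) (n : ℕ) (args : Fin n → SlotExp)
  | newPayable (A : Ident) (value : SlotExp) (n : ℕ) (args : Fin n → SlotExp)
  | ref (r : Ref) (ann : Ident)
  | addr (se : SlotExp)

/-- `σ x := se` -/
structure Create where
  ty : SlotTy
  name : Ident
  rhs : SlotExp

/-- `ref := se`, with the annotation of `ref`. -/
structure Update where
  ref : Ref
  ann : SlotTy
  rhs : SlotExp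

/-- Interfaces `(xᵢ : αᵢ)`. -/
abbrev Iface := List (Ident × ABITy)

/-- The interface as a partial function. -/
def Iface.ty (I : Iface) (x : Ident) : Option ABITy := List.lookup x I

def Iface.names (I : Iface) : List Ident := I.map Prod.fst

/-- `case cond : creates creates` -/
structure CtorCase where
  cond : Exp
  creates : List Create

structure Ctor where
  iface : Iface
  payable : Bool
  iffs : List Exp
  cases : List CtorCase
  posts : List Exp

/-- `case cond : updates updates [returns ret]` -/
structure TransCase where
  cond : Exp
  updates : List Update
  ret : Option Exp

structure Trans where
  name : Ident
  iface : Iface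
  payable : Bool
  retTy : Option ABITy
  iffs : List Exp
  cases : List TransCase
  posts : List Exp

/-- Storage typings of a contract. -/
abbrev StorageTy := Ident → Option SlotTy

/-- State typings (contract signatures). -/
structure Sig where
  storage : Ident → Option StorageTy
  cnstr : Ident → Option Ctor
  trans : Ident → Option (List Trans)

/-- `S` with `A : C` added to its storage typings. -/
def Sig.withStorage (S : Sig) (A : Ident) (C : StorageTy) : Sig :=
  { S with storage := Function.update S.storage A (some C) }

/-- Inclusion of signatures, as triples of partial functions. -/
def Sig.Sub (S₁ S : Sig) : Prop :=
  (∀ A C, S₁.storage A = some C → S.storage A = some C) ∧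
  (∀ A c, S₁.cnstr A = some c → S.cnstr A = some c) ∧
  (∀ A t, S₁.trans A = some t → S.trans A = some t)

def Sig.StrictSub (S₁ S : Sig) : Prop := S₁.Sub S ∧ S₁ ≠ S

/-- Finite conjunctions and disjunctions of expressions. -/
def bigAnd (es : List Exp) : Exp := es.foldr (Exp.bopB .and) (.bool true)

def bigOr (es : List Exp) : Exp := es.foldr (Exp.bopB .or) (.bool false)

/-- The list of all `¬ (eᵢ ∧ eⱼ)` with `i < j`. -/
def pairwiseExclusive : List Exp → List Exp
  | [] => []
  | e :: es => es.map (fun e₁ => .neg (.bopB .and e e₁)) ++ pairwiseExclusive es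

/-- `⋀ pres ⇒ ((⋁ᵢ eᵢ) ∧ ⋀_{i < j} ¬ (eᵢ ∧ eⱼ))` -/
def exactlyOneCase (pres conds : List Exp) : Exp :=
  .bopB .imp (bigAnd pres) (.bopB .and (bigOr conds) (bigAnd (pairwiseExclusive conds)))

/-! ## Semantics of references and base expressions -/

/-- A single state, or a pair of a pre-state and a post-state. -/
inductive TState where
  | untimed (s : State)
  | timed (pre post : State)

/-- The timing of an evaluated reference. -/
inductive RefTime where
  | untimed | pre | post

/-- Evaluation of environment references at the location `ℓ`. -/
inductive EvalEnv (ρ : Env) (ℓ : Addr) : EnvRef → BaseValue → Prop where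
  | caller {b} (h : ρ .caller = some b) : EvalEnv ρ ℓ .caller b
  | origin {b} (h : ρ .origin = some b) : EvalEnv ρ ℓ .origin b
  | callvalue {b} (h : ρ .callvalue = some b) : EvalEnv ρ ℓ .callvalue b
  | this : EvalEnv ρ ℓ .this (.addr ℓ)

/-- Integer operators other than division and remainder; a power with a negative exponent is
undefined. -/
def IntOp.eval : IntOp → ℤ → ℤ → Option ℤ
  | .add, a, b => some (a + b)
  | .sub, a, b => some (a - b)
  | .mul, a, b => some (a * b)
  | .exp, a, b => if 0 ≤ b then some (a ^ b.toNat) else none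
  | .div, _, _ => none
  | .mod, _, _ => none

def BoolOp.eval : BoolOp → Bool → Bool → Bool
  | .and, a, b => a && b
  | .or, a, b => a || b
  | .imp, a, b => !a || b

def CmpOp.eval : CmpOp → ℤ → ℤ → Bool
  | .lt, a, b => decide (a < b)
  | .le, a, b => decide (a ≤ b)
  | .ge, a, b => decide (a ≥ b)
  | .gt, a, b => decide (a > b)

mutual
/-- `EvalRef ts ρ ℓ r v t` : the reference `r` evaluates to `v` with timing `t`. -/
inductive EvalRef : TState → Env → Addr → Ref → Value → RefTime → Prop where
  | environment {ts ρ ℓ k b} (h : EvalEnv ρ ℓ k b) :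
      EvalRef ts ρ ℓ (.env k) (.base b) .untimed
  | storage {s : State} {ρ ℓ x v} (hx : s.read ℓ x = some v) (hρ : ρ (.var x) = none) :
      EvalRef (.untimed s) ρ ℓ (.var x) v .untimed
  | storagePre {s s₂ : State} {ρ ℓ x v} (hx : s.read ℓ x = some v) (hρ : ρ (.var x) = none) :
      EvalRef (.timed s s₂) ρ ℓ (.pre x) v .pre
  | storagePost {s s₂ : State} {ρ ℓ x v} (hx : s₂.read ℓ x = some v) (hρ : ρ (.var x) = none) :
      EvalRef (.timed s s₂) ρ ℓ (.post x) v .post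
  | calldata {s : State} {ρ ℓ x b} (h : ρ (.var x) = some b) :
      EvalRef (.untimed s) ρ ℓ (.var x) (.base b) .untimed
  | calldataTimed {s s₂ : State} {ρ ℓ x b} (h : ρ (.var x) = some b) :
      EvalRef (.timed s s₂) ρ ℓ (.var x) (.base b) .pre
  | coerce {ts ρ ℓ r A v t} (h : EvalRef ts ρ ℓ r v t) :
      EvalRef ts ρ ℓ (.coerce r A) v t
  | field {s : State} {ρ ℓ r ℓ₁ x v}
      (h : EvalRef (.untimed s) ρ ℓ r (.base (.addr ℓ₁)) .untimed)
      (hx : s.read ℓ₁ x = some v) :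
      EvalRef (.untimed s) ρ ℓ (.field r x) v .untimed
  | fieldPre {s s₂ : State} {ρ ℓ r ℓ₁ x v}
      (h : EvalRef (.timed s s₂) ρ ℓ r (.base (.addr ℓ₁)) .pre)
      (hx : s.read ℓ₁ x = some v) :
      EvalRef (.timed s s₂) ρ ℓ (.field r x) v .pre
  | fieldPost {s s₂ : State} {ρ ℓ r ℓ₁ x v}
      (h : EvalRef (.timed s s₂) ρ ℓ r (.base (.addr ℓ₁)) .post)
      (hx : s₂.read ℓ₁ x = some v) :
      EvalRef (.timed s s₂) ρ ℓ (.field r x) v .post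
  | index {ts ρ ℓ r e t} {X : Kind} {a : X.Carrier} {f : X.Carrier → Value}
      (he : EvalExp ts ρ ℓ e (.base (X.inj a)))
      (hr : EvalRef ts ρ ℓ r (.fn X f) t) :
      EvalRef ts ρ ℓ (.index r e) (f a) t
/-- `EvalExp ts ρ ℓ e v` : the base expression `e` evaluates to `v`. -/
inductive EvalExp : TState → Env → Addr → Exp → Value → Prop where
  | int {ts ρ ℓ n} : EvalExp ts ρ ℓ (.int n) (.base (.int n))
  | bool {ts ρ ℓ b} : EvalExp ts ρ ℓ (.bool b) (.base (.bool b))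
  | ref {ts ρ ℓ r ann v t} (h : EvalRef ts ρ ℓ r v t) : EvalExp ts ρ ℓ (.ref r ann) v
  | addr {ts ρ ℓ r ann v t} (h : EvalRef ts ρ ℓ r v t) : EvalExp ts ρ ℓ (.addr r ann) v
  | rangeTrue {ts ρ ℓ ι e n} (h : EvalExp ts ρ ℓ e (.base (.int n))) (hn : ι.Mem n) :
      EvalExp ts ρ ℓ (.inrange ι e) vTrue
  | rangeFalse {ts ρ ℓ ι e n} (h : EvalExp ts ρ ℓ e (.base (.int n))) (hn : ¬ ι.Mem n) :
      EvalExp ts ρ ℓ (.inrange ι e) vFalse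
  | div {ts ρ ℓ e₁ e₂ n₁ n₂} (h₁ : EvalExp ts ρ ℓ e₁ (.base (.int n₁)))
      (h₂ : EvalExp ts ρ ℓ e₂ (.base (.int n₂))) (h : n₂ ≠ 0) :
      EvalExp ts ρ ℓ (.bopI .div e₁ e₂) (.base (.int (n₁ / n₂)))
  | divZero {ts ρ ℓ e₁ e₂ n₁ n₂} (h₁ : EvalExp ts ρ ℓ e₁ (.base (.int n₁)))
      (h₂ : EvalExp ts ρ ℓ e₂ (.base (.int n₂))) (h : n₂ = 0) :
      EvalExp ts ρ ℓ (.bopI .div e₁ e₂) (.base (.int 0))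
  | mod {ts ρ ℓ e₁ e₂ n₁ n₂} (h₁ : EvalExp ts ρ ℓ e₁ (.base (.int n₁)))
      (h₂ : EvalExp ts ρ ℓ e₂ (.base (.int n₂))) (h : n₂ ≠ 0) :
      EvalExp ts ρ ℓ (.bopI .mod e₁ e₂) (.base (.int (n₁ % n₂)))
  | modZero {ts ρ ℓ e₁ e₂ n₁ n₂} (h₁ : EvalExp ts ρ ℓ e₁ (.base (.int n₁)))
      (h₂ : EvalExp ts ρ ℓ e₂ (.base (.int n₂))) (h : n₂ = 0) :
      EvalExp ts ρ ℓ (.bopI .mod e₁ e₂) (.base (.int 0))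
  | bopI {ts ρ ℓ op e₁ e₂ n₁ n₂ n} (h₁ : EvalExp ts ρ ℓ e₁ (.base (.int n₁)))
      (h₂ : EvalExp ts ρ ℓ e₂ (.base (.int n₂))) (h : op ≠ .div ∧ op ≠ .mod)
      (hn : op.eval n₁ n₂ = some n) :
      EvalExp ts ρ ℓ (.bopI op e₁ e₂) (.base (.int n))
  | bopB {ts ρ ℓ op e₁ e₂ b₁ b₂} (h₁ : EvalExp ts ρ ℓ e₁ (.base (.bool b₁)))
      (h₂ : EvalExp ts ρ ℓ e₂ (.base (.bool b₂))) :
      EvalExp ts ρ ℓ (.bopB op e₁ e₂) (.base (.bool (op.eval b₁ b₂)))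
  | neg {ts ρ ℓ e b} (h : EvalExp ts ρ ℓ e (.base (.bool b))) :
      EvalExp ts ρ ℓ (.neg e) (.base (.bool (!b)))
  | cmp {ts ρ ℓ op e₁ e₂ n₁ n₂} (h₁ : EvalExp ts ρ ℓ e₁ (.base (.int n₁)))
      (h₂ : EvalExp ts ρ ℓ e₂ (.base (.int n₂))) :
      EvalExp ts ρ ℓ (.cmp op e₁ e₂) (.base (.bool (op.eval n₁ n₂)))
  | iteTrue {ts ρ ℓ e₁ e₂ e₃ v} (h₁ : EvalExp ts ρ ℓ e₁ vTrue) (h₂ : EvalExp ts ρ ℓ e₂ v) :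
      EvalExp ts ρ ℓ (.ite e₁ e₂ e₃) v
  | iteFalse {ts ρ ℓ e₁ e₂ e₃ v} (h₁ : EvalExp ts ρ ℓ e₁ vFalse) (h₃ : EvalExp ts ρ ℓ e₃ v) :
      EvalExp ts ρ ℓ (.ite e₁ e₂ e₃) v
  | eqTrue {ts ρ ℓ e₁ e₂ v₁ v₂} (h₁ : EvalExp ts ρ ℓ e₁ v₁) (h₂ : EvalExp ts ρ ℓ e₂ v₂)
      (h : v₁ = v₂) : EvalExp ts ρ ℓ (.eq e₁ e₂) vTrue
  | eqFalse {ts ρ ℓ e₁ e₂ v₁ v₂} (h₁ : EvalExp ts ρ ℓ e₁ v₁) (h₂ : EvalExp ts ρ ℓ e₂ v₂)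
      (h : v₁ ≠ v₂) : EvalExp ts ρ ℓ (.eq e₁ e₂) vFalse
end

/-- `Insert ρ ℓ s r v s₂` : writing `v` at the reference `r` turns `s` into `s₂`. -/
inductive Insert (ρ : Env) (ℓ : Addr) : State → Ref → Value → State → Prop where
  | storage {s : State} {x v o} (ho : s ℓ = some o) (hx : (o.store x).isSome) :
      Insert ρ ℓ s (.var x) v
        (Function.update s ℓ (some { o with store := Function.update o.store x (some v) }))
  | field {s : State} {r ℓ₁ x v o}
      (hr : EvalRef (.untimed s) ρ ℓ r (.base (.addr ℓ₁)) .untimed)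
      (ho : s ℓ₁ = some o) (hx : (o.store x).isSome) :
      Insert ρ ℓ s (.field r x) v
        (Function.update s ℓ₁ (some { o with store := Function.update o.store x (some v) }))

/-! ## Semantics of mapping and slot expressions, creates and updates -/

/-- The function `a ↦ if a = kᵢ then uᵢ else g a` (with the first matching `i`). -/
def overrideFn {X : Kind} {n : ℕ} (k : Fin n → X.Carrier) (u : Fin n → Value)
    (g : X.Carrier → Value) : X.Carrier → Value :=
  fun a => ((List.ofFn (fun i => (k i, u i))).lookup a).getD (g a)

/-- Evaluation of mapping expressions. -/
inductive EvalMap (s : State) (ρ : Env) (ℓ : Addr) : MapExp → Value → Prop where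
  | exp {e v} (h : EvalExp (.untimed s) ρ ℓ e v) : EvalMap s ρ ℓ (.exp e) v
  | lit {n keys vals} {β : BaseTy} {μ : MapTy} {k : Fin n → β.kind.Carrier} {u : Fin n → Value}
      (hk : ∀ i, EvalExp (.untimed s) ρ ℓ (keys i) (.base (β.kind.inj (k i))))
      (hu : ∀ i, EvalMap s ρ ℓ (vals i) (u i)) :
      EvalMap s ρ ℓ (.lit n keys vals (.mapping β μ))
        (.fn β.kind (overrideFn k u (fun _ => μ.default)))
  | upd {r n keys vals t} {β : BaseTy} {μ : MapTy} {f : β.kind.Carrier → Value}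
      {k : Fin n → β.kind.Carrier} {u : Fin n → Value}
      (hr : EvalRef (.untimed s) ρ ℓ r (.fn β.kind f) t)
      (hk : ∀ i, EvalExp (.untimed s) ρ ℓ (keys i) (.base (β.kind.inj (k i))))
      (hu : ∀ i, EvalMap s ρ ℓ (vals i) (u i)) :
      EvalMap s ρ ℓ (.upd r n keys vals (.mapping β μ)) (.fn β.kind (overrideFn k u f))

/-- `IsFresh s ℓ` : `ℓ = max (dom s) + 1`, where the maximum of the empty set is `0`. -/
def IsFresh (s : State) (ℓ : Addr) : Prop := ∃ m, IsLUB s.dom m ∧ ℓ = m + 1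

mutual
/-- `EvalSlot S d s ρ ℓ se v s₂` : the slot expression `se` evaluates to `v` and changes the
state from `s` to `s₂`. -/
inductive EvalSlot (S : Sig) (d : Addr) :
    State → Env → Addr → SlotExp → Value → State → Prop where
  | map {s ρ ℓ m v} (h : EvalMap s ρ ℓ m v) : EvalSlot S d s ρ ℓ (.map m) v s
  | ref {s ρ ℓ r ann v t} (h : EvalRef (.untimed s) ρ ℓ r v t) :
      EvalSlot S d s ρ ℓ (.ref r ann) v s
  | addr {s ρ ℓ se v s₂} (h : EvalSlot S d s ρ ℓ se v s₂) :
      EvalSlot S d s ρ ℓ (.addr se) v s₂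
  | new {ρ ℓ A n args ctor o ℓ₁ s₂} {st : Fin (n + 1) → State} {b : Fin n → BaseValue}
      (hctor : S.cnstr A = some ctor) (hpay : ctor.payable = false)
      (hlen : ctor.iface.length = n)
      (hargs : ∀ i : Fin n,
        EvalSlot S d (st i.castSucc) ρ ℓ (args i) (.base (b i)) (st i.succ))
      (ho : ρ .origin = some o)
      (hcases : EvalCtorCases S d (st (Fin.last n))
        (callEnv ctor.iface.names (List.ofFn b) (.addr ℓ) o (.int 0)) ctor.cases A ℓ₁ s₂) :
      EvalSlot S d (st 0) ρ ℓ (.new A n args) (.base (.addr ℓ₁)) s₂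
  | newPayable {ρ ℓ A n args value ctor o w s₁ ℓ₁ s₂} {st : Fin (n + 1) → State}
      {b : Fin n → BaseValue}
      (hctor : S.cnstr A = some ctor) (hpay : ctor.payable = true)
      (hlen : ctor.iface.length = n)
      (hargs : ∀ i : Fin n,
        EvalSlot S d (st i.castSucc) ρ ℓ (args i) (.base (b i)) (st i.succ))
      (hvalue : EvalSlot S d (st (Fin.last n)) ρ ℓ value (.base w) s₁)
      (ho : ρ .origin = some o)
      (hcases : EvalCtorCases S d s₁
        (callEnv ctor.iface.names (List.ofFn b) (.addr ℓ) o w) ctor.cases A ℓ₁ s₂) :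
      EvalSlot S d (st 0) ρ ℓ (.newPayable A value n args) (.base (.addr ℓ₁)) s₂
/-- `EvalCreates S d s ρ cs A ℓ s₂` : the creates `cs` make a new instance of `A` at `ℓ`. -/
inductive EvalCreates (S : Sig) (d : Addr) :
    State → Env → List Create → Ident → Addr → State → Prop where
  | intro {ρ A ℓ} {cs : List Create} {st : Fin (cs.length + 1) → State}
      {v : Fin cs.length → Value}
      (hse : ∀ i : Fin cs.length,
        EvalSlot S d (st i.castSucc) ρ d (cs.get i).rhs (v i) (st i.succ))
      (hℓ : IsFresh (st (Fin.last cs.length)) ℓ) :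
      EvalCreates S d (st 0) ρ cs A ℓ
        (Function.update (st (Fin.last cs.length)) ℓ
          (some ⟨A, fun x => ((cs.map Create.name).zip (List.ofFn v)).lookup x⟩))
/-- `EvalCtorCases S d s ρ cases A ℓ s₂` : exactly one case condition holds, and its creates make
a new instance of `A` at `ℓ`. -/
inductive EvalCtorCases (S : Sig) (d : Addr) :
    State → Env → List CtorCase → Ident → Addr → State → Prop where
  | intro {s ρ A ℓ s₂} {cases : List CtorCase} (j : Fin cases.length)
      (hj : EvalExp (.untimed s) ρ d (cases.get j).cond vTrue)
      (hi : ∀ i : Fin cases.length, i ≠ j →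
        EvalExp (.untimed s) ρ d (cases.get i).cond vFalse)
      (hc : EvalCreates S d s ρ (cases.get j).creates A ℓ s₂) :
      EvalCtorCases S d s ρ cases A ℓ s₂
end

/-- All right-hand sides are evaluated first, then the values are written in order. -/
def EvalUpdates (S : Sig) (d : Addr) (s : State) (ρ : Env) (ℓ : Addr) (us : List Update)
    (s₂ : State) : Prop :=
  ∃ (st wr : Fin (us.length + 1) → State) (v : Fin us.length → Value),
    st 0 = s ∧
    (∀ i : Fin us.length,
      EvalSlot S d (st i.castSucc) ρ ℓ (us.get i).rhs (v i) (st i.succ)) ∧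
    wr 0 = st (Fin.last us.length) ∧
    (∀ i : Fin us.length,
      Insert ρ ℓ (wr i.castSucc) (us.get i).ref (v i) (wr i.succ)) ∧
    wr (Fin.last us.length) = s₂

/-- Evaluation of an optional return expression in a pair of states. -/
def EvalRet (s s₂ : State) (ρ : Env) (ℓ : Addr) : Option Exp → Option Value → Prop
  | none, w => w = none
  | some e, w => ∃ v, w = some v ∧ EvalExp (.timed s s₂) ρ ℓ e v

def EvalTransCases (S : Sig) (d : Addr) (s : State) (ρ : Env) (ℓ : Addr)
    (cases : List TransCase) (w : Option Value) (s₂ : State) : Prop :=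
  ∃ j : Fin cases.length,
    EvalExp (.untimed s) ρ ℓ (cases.get j).cond vTrue ∧
    (∀ i : Fin cases.length, i ≠ j → EvalExp (.untimed s) ρ ℓ (cases.get i).cond vFalse) ∧
    EvalUpdates S d s ρ ℓ (cases.get j).updates s₂ ∧
    EvalRet s s₂ ρ ℓ (cases.get j).ret w

def EvalCtor (S : Sig) (d : Addr) (s : State) (ρ : Env) (c : Ctor) (A : Ident) (ℓ : Addr)
    (s₂ : State) : Prop :=
  (∀ p ∈ c.iffs, EvalExp (.untimed s) ρ d p vTrue) ∧ EvalCtorCases S d s ρ c.cases A ℓ s₂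

def EvalTrans (S : Sig) (d : Addr) (s : State) (ρ : Env) (ℓ : Addr) (tr : Trans)
    (w : Option Value) (s₂ : State) : Prop :=
  (∀ p ∈ tr.iffs, EvalExp (.untimed s) ρ ℓ p vTrue) ∧ EvalTransCases S d s ρ ℓ tr.cases w s₂

/-! ## Typing of values and environments -/

inductive HasBaseTy : BaseValue → BaseTy → Prop where
  | addr {ℓ} : HasBaseTy (.addr ℓ) .address
  | bool {b} : HasBaseTy (.bool b) .bool
  | int {n ι} (h : ι.Mem n) : HasBaseTy (.int n) (.int ι)

inductive HasMapTy : Value → MapTy → Prop where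
  | base {b β} (h : HasBaseTy b β) : HasMapTy (.base b) (.base β)
  | mapping {β : BaseTy} {μ : MapTy} {f : β.kind.Carrier → Value}
      (h : ∀ a, HasBaseTy (β.kind.inj a) β → HasMapTy (f a) μ) :
      HasMapTy (.fn β.kind f) (.mapping β μ)

/-- Typing of values by slot types in the state `s`. -/
inductive HasSlotTy (S : Sig) (s : State) : Value → SlotTy → Prop where
  | map {v μ} (h : HasMapTy v μ) : HasSlotTy S s v (.map μ)
  | addrIsContract {ℓ o A C} (ho : s ℓ = some o) (hC : S.storage A = some C)
      (htype : o.type = A)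
      (hdom : ∀ x, (o.store x).isSome ↔ ∃ σ, C x = some σ)
      (hval : ∀ x σ v, C x = some σ → o.store x = some v → HasSlotTy S s v σ) :
      HasSlotTy S s (.base (.addr ℓ)) (.addressOf A)
  | contract {ℓ A} (h : HasSlotTy S s (.base (.addr ℓ)) (.addressOf A)) :
      HasSlotTy S s (.base (.addr ℓ)) (.contract A)

/-- Typing of a location by an optional contract; every location has type `none`. -/
def HasLocTy (S : Sig) (s : State) (ℓ : Addr) : Option Ident → Prop
  | none => True
  | some A => HasSlotTy S s (.base (.addr ℓ)) (.contract A)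

/-- Typing of environments by interfaces in the state `s`. -/
structure HasEnvTy (S : Sig) (s : State) (ρ : Env) (I : Iface) : Prop where
  dom : ∀ x, (ρ (.var x)).isSome ↔ (I.ty x).isSome
  vars : ∀ x α b, I.ty x = some α → ρ (.var x) = some b → HasSlotTy S s (.base b) α.toSlot
  caller : ∃ b, ρ .caller = some b ∧ HasBaseTy b .address
  origin : ∃ b, ρ .origin = some b ∧ HasBaseTy b .address
  callvalue : ∃ b, ρ .callvalue = some b ∧ HasBaseTy b BaseTy.uint256

/-! ## Semantic entailment -/

/-- `e` is true in all well-typed configurations in which `Φ` is true. -/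
def Entails (S : Sig) (I : Iface) (Φ : Exp) (A? : Option Ident) (e : Exp) : Prop :=
  ∀ (s : State) (ρ : Env) (ℓ : Addr), HasEnvTy S s ρ I → HasLocTy S s ℓ A? →
    EvalExp (.untimed s) ρ ℓ Φ vTrue → EvalExp (.untimed s) ρ ℓ e vTrue

/-- The preconditions `pres` of a constructor with parameters `xs` are true after evaluation of
the arguments `se`, in all well-typed configurations in which `Φ` is true. -/
def EntailsIffs (S : Sig) (d : Addr) (I : Iface) (Φ : Exp) (A? : Option Ident) {n : ℕ}
    (se : Fin n → SlotExp) (xs : List Ident) (pres : List Exp) : Prop :=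
  ∀ (st : Fin (n + 1) → State) (ρ : Env) (ℓ : Addr) (b : Fin n → BaseValue),
    HasEnvTy S (st 0) ρ I → HasLocTy S (st 0) ℓ A? →
    EvalExp (.untimed (st 0)) ρ ℓ Φ vTrue →
    (∀ i : Fin n, EvalSlot S d (st i.castSucc) ρ ℓ (se i) (.base (b i)) (st i.succ)) →
    ∀ p ∈ pres, EvalExp (.untimed (st (Fin.last n))) (bindArgs xs (List.ofFn b)) d p vTrue

/-! ## Typing -/

inductive ABIWf (S : Sig) : ABITy → Prop where
  | int {ι : IntTy} (h : ι ≠ .unbounded) : ABIWf S (.base (.int ι))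
  | contractAddr {α : ABITy} (h : ∀ A, α = .addressOf A → (S.storage A).isSome) : ABIWf S α

inductive SlotWf (S : Sig) : SlotTy → Prop where
  | contract {A} (h : (S.storage A).isSome) : SlotWf S (.contract A)
  | alpha {α : ABITy} (h : ABIWf S α) : SlotWf S α.toSlot
  | map {μ} : SlotWf S (.map μ)

def IfaceWf (S : Sig) (I : Iface) : Prop := ∀ p ∈ I, ABIWf S p.2

/-- Timing tag of a judgment. -/
inductive Timing where
  | untimed | timed

/-- Reference tag: `storage` for references reachable from the storage of the current contract
without coercion, `other` for all others. -/
inductive RefTag where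
  | storage | other

inductive EnvHasTy : Option Ident → EnvRef → ABITy → Prop where
  | caller {A?} : EnvHasTy A? .caller (.base .address)
  | origin {A?} : EnvHasTy A? .origin (.base .address)
  | callvalue {A?} : EnvHasTy A? .callvalue (.base BaseTy.uint256)
  | this {A} : EnvHasTy (some A) .this (.addressOf A)

mutual
/-- Typing of references. -/
inductive RefHasTy (S : Sig) (I : Iface) :
    RefTag → Option Ident → Timing → Ref → SlotTy → Prop where
  | calldata {A? t x α} (h : I.ty x = some α) :
      RefHasTy S I .other A? t (.var x) α.toSlot
  | storage {A C x σ} (hC : S.storage A = some C) (hx : C x = some σ) (hI : I.ty x = none) :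
      RefHasTy S I .storage (some A) .untimed (.var x) σ
  | storagePre {A C x σ} (hC : S.storage A = some C) (hx : C x = some σ) (hI : I.ty x = none) :
      RefHasTy S I .storage (some A) .timed (.pre x) σ
  | storagePost {A C x σ} (hC : S.storage A = some C) (hx : C x = some σ) (hI : I.ty x = none) :
      RefHasTy S I .storage (some A) .timed (.post x) σ
  | coerce {k A? t r A} (h : RefHasTy S I k A? t r (.addressOf A)) :
      RefHasTy S I .other A? t (.coerce r A) (.contract A)
  | upcast {k A? t r A} (h : RefHasTy S I k A? t r (.addressOf A)) :
      RefHasTy S I .other A? t r BaseTy.address.toSlot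
  | field {k A? t r A C x σ} (h : RefHasTy S I k A? t r (.contract A))
      (hC : S.storage A = some C) (hx : C x = some σ) :
      RefHasTy S I k A? t (.field r x) σ
  | index {k A? t r e β μ} (hr : RefHasTy S I k A? t r (.map (.mapping β μ)))
      (he : ExpHasTy S I (.bool true) A? t e β) :
      RefHasTy S I .other A? t (.index r e) (.map μ)
  | environment {A? k α} (h : EnvHasTy A? k α) :
      RefHasTy S I .other A? .untimed (.env k) α.toSlot
/-- Typing of base expressions. -/
inductive ExpHasTy (S : Sig) (I : Iface) :
    Exp → Option Ident → Timing → Exp → BaseTy → Prop where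
  | int {Φ A? t n ι} (h : ι.Mem n) : ExpHasTy S I Φ A? t (.int n) (.int ι)
  | bool {Φ A? t b} : ExpHasTy S I Φ A? t (.bool b) .bool
  | ref {Φ A? t k r β} (h : RefHasTy S I k A? t r β.toSlot) :
      ExpHasTy S I Φ A? t (.ref r (.base β)) β
  | addr {Φ A? k r A} (h : RefHasTy S I k A? .untimed r (.contract A)) :
      ExpHasTy S I Φ A? .untimed (.addr r A) .address
  | range {Φ A? t ι₁ ι₂ e} (h : ExpHasTy S I Φ A? t e (.int ι₂)) :
      ExpHasTy S I Φ A? t (.inrange ι₁ e) .bool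
  | bopI {Φ A? t op e₁ e₂ ι₁ ι₂ ι} (h₁ : ExpHasTy S I Φ A? t e₁ (.int ι₁))
      (h₂ : ExpHasTy S I Φ A? t e₂ (.int ι₂))
      (ht : t = .timed → ι = .unbounded)
      (hr : t = .untimed → Entails S I Φ A? (.inrange ι (.bopI op e₁ e₂))) :
      ExpHasTy S I Φ A? t (.bopI op e₁ e₂) (.int ι)
  | numConv {Φ A? t e ι₁ ι₂} (h : ExpHasTy S I Φ A? t e (.int ι₁))
      (hr : ι₂ ≠ .unbounded → Entails S I Φ A? (.inrange ι₂ e)) :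
      ExpHasTy S I Φ A? t e (.int ι₂)
  | bopB {Φ A? t op e₁ e₂} (h₁ : ExpHasTy S I Φ A? t e₁ .bool)
      (h₂ : ExpHasTy S I Φ A? t e₂ .bool) :
      ExpHasTy S I Φ A? t (.bopB op e₁ e₂) .bool
  | neg {Φ A? t e} (h : ExpHasTy S I Φ A? t e .bool) : ExpHasTy S I Φ A? t (.neg e) .bool
  | cmp {Φ A? t op e₁ e₂ ι} (h₁ : ExpHasTy S I Φ A? t e₁ (.int ι))
      (h₂ : ExpHasTy S I Φ A? t e₂ (.int ι)) :
      ExpHasTy S I Φ A? t (.cmp op e₁ e₂) .bool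
  | ite {Φ A? t e₁ e₂ e₃ β} (h₁ : ExpHasTy S I Φ A? t e₁ .bool)
      (h₂ : ExpHasTy S I Φ A? t e₂ β) (h₃ : ExpHasTy S I Φ A? t e₃ β) :
      ExpHasTy S I Φ A? t (.ite e₁ e₂ e₃) β
  | eq {Φ A? t e₁ e₂ β} (h₁ : ExpHasTy S I Φ A? t e₁ β) (h₂ : ExpHasTy S I Φ A? t e₂ β) :
      ExpHasTy S I Φ A? t (.eq e₁ e₂) .bool
end

/-- Typing of mapping expressions. -/
inductive MapHasTy (S : Sig) (I : Iface) (Φ : Exp) (A? : Option Ident) :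
    MapExp → MapTy → Prop where
  | exp {e β} (h : ExpHasTy S I Φ A? .untimed e β) : MapHasTy S I Φ A? (.exp e) (.base β)
  | lit {n keys vals β μ} (hk : ∀ i : Fin n, ExpHasTy S I Φ A? .untimed (keys i) β)
      (hv : ∀ i : Fin n, MapHasTy S I Φ A? (vals i) μ) :
      MapHasTy S I Φ A? (.lit n keys vals (.mapping β μ)) (.mapping β μ)
  | upd {k r n keys vals β μ} (hr : RefHasTy S I k A? .untimed r (.map (.mapping β μ)))
      (hk : ∀ i : Fin n, ExpHasTy S I Φ A? .untimed (keys i) β)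
      (hv : ∀ i : Fin n, MapHasTy S I Φ A? (vals i) μ) :
      MapHasTy S I Φ A? (.upd r n keys vals (.mapping β μ)) (.mapping β μ)

/-- Typing of slot expressions. -/
inductive SlotHasTy (S : Sig) (d : Addr) (I : Iface) (Φ : Exp) (A? : Option Ident) :
    SlotExp → SlotTy → Prop where
  | map {m μ} (h : MapHasTy S I Φ A? m μ) : SlotHasTy S d I Φ A? (.map m) (.map μ)
  | ref {k r A} (h : RefHasTy S I k A? .untimed r (.contract A)) :
      SlotHasTy S d I Φ A? (.ref r A) (.contract A)
  | addr {se A} (h : SlotHasTy S d I Φ A? se (.contract A)) :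
      SlotHasTy S d I Φ A? (.addr se) (.addressOf A)
  | new {A ctor} {args : Fin ctor.iface.length → SlotExp}
      (hctor : S.cnstr A = some ctor) (hpay : ctor.payable = false)
      (hargs : ∀ j, SlotHasTy S d I Φ A? (args j) (ctor.iface.get j).2.toSlot)
      (hiffs : EntailsIffs S d I Φ A? args ctor.iface.names ctor.iffs) :
      SlotHasTy S d I Φ A? (.new A ctor.iface.length args) (.contract A)
  | newPayable {A ctor value} {args : Fin ctor.iface.length → SlotExp}
      (hctor : S.cnstr A = some ctor) (hpay : ctor.payable = true)
      (hargs : ∀ j, SlotHasTy S d I Φ A? (args j) (ctor.iface.get j).2.toSlot)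
      (hvalue : SlotHasTy S d I Φ A? value BaseTy.uint256.toSlot)
      (hiffs : EntailsIffs S d I Φ A? args ctor.iface.names ctor.iffs) :
      SlotHasTy S d I Φ A? (.newPayable A value ctor.iface.length args) (.contract A)

/-- The storage typing `(xᵢ : σᵢ)` declared by a list of creates. -/
def storageOf (cs : List Create) : StorageTy :=
  fun x => (cs.map (fun c => (c.name, c.ty))).lookup x

/-- Typing of creates: they declare the storage `C`, which has a balance. -/
def CreatesHasTy (S : Sig) (d : Addr) (I : Iface) (Φ : Exp) (cs : List Create)
    (C : StorageTy) : Prop :=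
  (∀ c ∈ cs, SlotWf S c.ty) ∧ C = storageOf cs ∧
  C balanceName = some BaseTy.uint256.toSlot ∧
  (∀ c ∈ cs, SlotHasTy S d I Φ none c.rhs c.ty)

/-- `r₁` is strictly more specific than `r₂`. -/
inductive MoreSpecific : Ref → Ref → Prop where
  | base {r x} : MoreSpecific (.field r x) r
  | step {r₁ r₂ x} (h : MoreSpecific r₁ r₂) : MoreSpecific (.field r₁ x) r₂

/-- Typing of a list of updates: only storage references are updated, and no reference is updated
before an equal or less specific one. -/
def UpdatesWt (S : Sig) (d : Addr) (I : Iface) (Φ : Exp) (A : Ident) (us : List Update) : Prop :=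
  (∀ u ∈ us, RefHasTy S I .storage (some A) .untimed u.ref u.ann ∧
    SlotHasTy S d I Φ (some A) u.rhs u.ann) ∧
  us.Pairwise (fun uj ui => ¬ (uj.ref = ui.ref ∨ MoreSpecific uj.ref ui.ref))

/-- Typing of the optional return expression by the optional declared return type. -/
def RetHasTy (S : Sig) (I : Iface) (A : Ident) : Option Exp → Option ABITy → Prop
  | none, none => True
  | some e, some (.base β) => ExpHasTy S I (.bool true) (some A) .timed e β
  | _, _ => False

/-- The judgment `S ⊢_A ctor : C`. -/
structure CtorHasTy (S : Sig) (d : Addr) (A : Ident) (c : Ctor) (C : StorageTy) : Prop where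
  wf : IfaceWf S c.iface
  iffs : ∀ p ∈ c.iffs, ExpHasTy S c.iface (.bool true) none .untimed p .bool
  conds : ∀ k ∈ c.cases, ExpHasTy S c.iface (.bool true) none .untimed k.cond .bool
  creates : ∀ k ∈ c.cases,
    CreatesHasTy S d c.iface (.bopB .and k.cond (bigAnd c.iffs)) k.creates C
  disjoint : ∀ x, C x = none ∨ c.iface.ty x = none
  posts : ∀ p ∈ c.posts,
    ExpHasTy (S.withStorage A C) c.iface (.bool true) (some A) .untimed p .bool
  oneCase : Entails S c.iface (.bool true) none
    (exactlyOneCase c.iffs (c.cases.map CtorCase.cond))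

/-- The judgment `S ⊢_A trans`. -/
structure TransWt (S : Sig) (d : Addr) (A : Ident) (tr : Trans) : Prop where
  wf : IfaceWf S tr.iface
  iffs : ∀ p ∈ tr.iffs, ExpHasTy S tr.iface (.bool true) (some A) .untimed p .bool
  conds : ∀ k ∈ tr.cases, ExpHasTy S tr.iface (.bool true) (some A) .untimed k.cond .bool
  updates : ∀ k ∈ tr.cases,
    UpdatesWt S d tr.iface (.bopB .and k.cond (bigAnd tr.iffs)) A k.updates
  rets : ∀ k ∈ tr.cases, RetHasTy S tr.iface A k.ret tr.retTy
  posts : ∀ p ∈ tr.posts, ExpHasTy S tr.iface (.bool true) (some A) .timed p .bool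
  oneCase : Entails S tr.iface (.bool true) (some A)
    (exactlyOneCase tr.iffs (tr.cases.map TransCase.cond))

/-- Well-typed signatures. `T A` and `U A` are the smaller well-typed signatures in which the
constructor and the transitions of `A` are typed. By `dom` every contract with a storage typing
has a constructor. -/
inductive WellTyped (d : Addr) : Sig → Prop where
  | intro {S : Sig} (T U : Ident → Sig)
      (dom : ∀ A, (S.storage A).isSome → (S.cnstr A).isSome)
      (cnstrSub : ∀ A, (S.cnstr A).isSome → (T A).StrictSub S)
      (cnstrWt : ∀ A, (S.cnstr A).isSome → WellTyped d (T A))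
      (cnstrTy : ∀ A c, S.cnstr A = some c →
        ∃ C, S.storage A = some C ∧ CtorHasTy (T A) d A c C)
      (transSub : ∀ A, (S.trans A).isSome → (U A).StrictSub S)
      (transWt : ∀ A, (S.trans A).isSome → WellTyped d (U A))
      (transTy : ∀ A trs, S.trans A = some trs → ∀ tr ∈ trs, TransWt (U A) d A tr) :
      WellTyped d S

/-! ## Transitions between states -/

/-- A constructor step, which creates an instance of `A` at `ℓ`. -/
def StepCnstr (S : Sig) (d : Addr) (A : Ident) (ℓ : Addr) (s s₂ : State) : Prop :=
  ∃ ρ c, S.cnstr A = some c ∧ HasEnvTy S s ρ c.iface ∧ EvalCtor S d s ρ c A ℓ s₂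

/-- A transition step of the instance of `A` at `ℓ`. -/
def StepTrans (S : Sig) (d : Addr) (A : Ident) (ℓ : Addr) (s s₂ : State) : Prop :=
  ∃ ρ trs tr w, HasSlotTy S s (.base (.addr ℓ)) (.contract A) ∧
    S.trans A = some trs ∧ tr ∈ trs ∧ HasEnvTy S s ρ tr.iface ∧ EvalTrans S d s ρ ℓ tr w s₂

def Step (S : Sig) (d : Addr) (s s₂ : State) : Prop :=
  (∃ A ℓ, StepCnstr S d A ℓ s s₂) ∨ (∃ A ℓ, StepTrans S d A ℓ s s₂)

/-- Reachability from the empty state. -/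
def Possible (S : Sig) (d : Addr) (s : State) : Prop :=
  Relation.ReflTransGen (Step S d) State.empty s

end Act

/-!
The typing `ℓ : A` looks recursively into the stores, so a write at one location may affect the
types of all others. The invariant is therefore that every object conforms to the storage typing of
its contract *shallowly*: an address in its store only has to point to an object with the right
contract name. This is a local condition, and objects keep their contract names.

In a well-typed signature shallow typing implies typing: the storage typing of a contract mentions
only contracts that are declared in a strictly smaller well-typed signature, so one can argue by
induction on well-typedness.

A constructor or transition is typed in a signature `S₁` smaller than the signature `S` in which it
runs, and the entailments in its typing are about configurations that are well-typed for `S₁` and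
evaluations in `S₁`. So the induction on the evaluation of slot expressions shows at the same time
that the evaluation is one in `S₁`.
-/

namespace Act

/-! ## Evaluation is deterministic and monotone -/

theorem Kind.inj_injective (X : Kind) : Function.Injective X.inj := by
  cases X <;> intro a b h <;> cases h <;> rfl

theorem EvalEnv.unique {ρ : Env} {ℓ : Addr} {k : EnvRef} {b b' : BaseValue}
    (h : EvalEnv ρ ℓ k b) (h' : EvalEnv ρ ℓ k b') : b = b' := by
  cases h <;> cases h' <;> simp_all only [Option.some.injEq]

mutual
theorem EvalRef.unique {ts : TState} {ρ : Env} {ℓ : Addr} : ∀ {r : Ref} {v v' : Value}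
    {t t' : RefTime}, EvalRef ts ρ ℓ r v t → EvalRef ts ρ ℓ r v' t' → v = v' ∧ t = t'
  | .var x, _, _, _, _, h, h' => by cases h <;> cases h' <;> simp_all
  | .pre x, _, _, _, _, h, h' => by cases h; cases h'; simp_all
  | .post x, _, _, _, _, h, h' => by cases h; cases h'; simp_all
  | .coerce r _, _, _, _, _, .coerce h, .coerce h' => h.unique h'
  | .field r x, _, _, _, _, h, h' => by
    have ih := @EvalRef.unique ts ρ ℓ r
    cases h <;> cases h' <;> grind
  | .index r e, _, _, _, _, h, h' => by
    have ihr := @EvalRef.unique ts ρ ℓ r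
    have ihe := @EvalExp.unique ts ρ ℓ e
    cases h with | index he hr =>
    cases h' with | index he' hr' =>
    obtain ⟨hf, rfl⟩ := ihr hr hr'
    cases hf
    have ha := ihe he he'
    rw [Value.base.injEq] at ha
    rw [Kind.inj_injective _ ha]
    exact ⟨rfl, rfl⟩
  | .env k, _, _, _, _, .environment h, .environment h' => ⟨by rw [h.unique h'], rfl⟩
theorem EvalExp.unique {ts : TState} {ρ : Env} {ℓ : Addr} : ∀ {e : Exp} {v v' : Value},
    EvalExp ts ρ ℓ e v → EvalExp ts ρ ℓ e v' → v = v'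
  | .int _, _, _, .int, .int => rfl
  | .bool _, _, _, .bool, .bool => rfl
  | .ref _ _, _, _, .ref h, .ref h' => (h.unique h').1
  | .addr _ _, _, _, .addr h, .addr h' => (h.unique h').1
  | .bopI op e₁ e₂, _, _, h, h' => by
    have ih₁ := @EvalExp.unique ts ρ ℓ e₁
    have ih₂ := @EvalExp.unique ts ρ ℓ e₂
    cases h <;> cases h' <;> grind
  | .bopB op e₁ e₂, _, _, h, h' => by
    have ih₁ := @EvalExp.unique ts ρ ℓ e₁
    have ih₂ := @EvalExp.unique ts ρ ℓ e₂
    cases h; cases h'; grind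
  | .cmp op e₁ e₂, _, _, h, h' => by
    have ih₁ := @EvalExp.unique ts ρ ℓ e₁
    have ih₂ := @EvalExp.unique ts ρ ℓ e₂
    cases h; cases h'; grind
  | .neg e, _, _, h, h' => by
    have ih := @EvalExp.unique ts ρ ℓ e
    cases h; cases h'; grind
  | .inrange ι e, _, _, h, h' => by
    have ih := @EvalExp.unique ts ρ ℓ e
    cases h <;> cases h' <;> grind
  | .ite e₁ e₂ e₃, _, _, h, h' => by
    have ih₁ := @EvalExp.unique ts ρ ℓ e₁
    have ih₂ := @EvalExp.unique ts ρ ℓ e₂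
    have ih₃ := @EvalExp.unique ts ρ ℓ e₃
    cases h <;> cases h' <;> grind [vTrue, vFalse]
  | .eq e₁ e₂, _, _, h, h' => by
    have ih₁ := @EvalExp.unique ts ρ ℓ e₁
    have ih₂ := @EvalExp.unique ts ρ ℓ e₂
    cases h <;> cases h' <;> grind
end

theorem EvalExp.mem_of_inrange {ts : TState} {ρ : Env} {ℓ : Addr} {ι : IntTy} {e : Exp}
    (h : EvalExp ts ρ ℓ (.inrange ι e) vTrue) :
    ∃ n, EvalExp ts ρ ℓ e (.base (.int n)) ∧ ι.Mem n := by
  generalize hv : vTrue = v at h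
  cases h with
  | rangeTrue h hn => exact ⟨_, h, hn⟩
  | rangeFalse => cases hv

theorem EvalExp.bigAnd {ts : TState} {ρ : Env} {ℓ : Addr} {es : List Exp}
    (h : ∀ e ∈ es, EvalExp ts ρ ℓ e vTrue) : EvalExp ts ρ ℓ (bigAnd es) vTrue := by
  induction es with
  | nil => exact .bool
  | cons e es ih =>
    rw [List.forall_mem_cons] at h
    exact .bopB h.1 (ih h.2)

/-- Inclusion of states as partial functions: no object is changed or lost. -/
def State.Sub (s s' : State) : Prop := ∀ ⦃ℓ o⦄, s ℓ = some o → s' ℓ = some o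

theorem State.Sub.refl (s : State) : s.Sub s := fun _ _ h => h

theorem State.Sub.trans {s₁ s₂ s₃ : State} (h : s₁.Sub s₂) (h' : s₂.Sub s₃) : s₁.Sub s₃ :=
  fun _ _ ho => h' (h ho)

theorem State.Sub.read {s s' : State} (h : s.Sub s') {ℓ : Addr} {x : Ident} {v : Value}
    (hx : s.read ℓ x = some v) : s'.read ℓ x = some v := by
  obtain ⟨o, ho, hv⟩ := Option.bind_eq_some_iff.1 hx
  exact Option.bind_eq_some_iff.2 ⟨o, h ho, hv⟩

/-- Componentwise inclusion of states or pairs of states. -/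
inductive TState.Sub : TState → TState → Prop where
  | untimed {s s'} (h : State.Sub s s') : TState.Sub (.untimed s) (.untimed s')
  | timed {s s' p p'} (h : State.Sub s s') (h' : State.Sub p p') :
      TState.Sub (.timed s p) (.timed s' p')

/-- `ρ'` may bind more keywords than `ρ`, but no more variables: an additional variable would hide
the storage variable of the same name. -/
structure Env.KeywordSub (ρ ρ' : Env) : Prop where
  var_eq : ∀ x, ρ' (.var x) = ρ (.var x)
  le : ∀ ⦃k b⦄, ρ k = some b → ρ' k = some b

theorem Env.KeywordSub.refl (ρ : Env) : ρ.KeywordSub ρ := ⟨fun _ => rfl, fun _ _ h => h⟩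

theorem bindArgs_keywordSub (xs : List Ident) (bs : List BaseValue) (c o w : BaseValue) :
    (bindArgs xs bs).KeywordSub (callEnv xs bs c o w) where
  var_eq _ := rfl
  le k _ h := by cases k <;> first | exact h | cases h

theorem EvalEnv.mono {ρ ρ' : Env} (hρ : ρ.KeywordSub ρ') {ℓ : Addr} {k : EnvRef} {b : BaseValue} :
    EvalEnv ρ ℓ k b → EvalEnv ρ' ℓ k b
  | .caller h => .caller (hρ.le h)
  | .origin h => .origin (hρ.le h)
  | .callvalue h => .callvalue (hρ.le h)
  | .this => .this

section Mono

variable {ρ ρ' : Env} {ℓ : Addr}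

mutual
theorem EvalRef.mono {ts ts' : TState} (hts : ts.Sub ts') (hρ : ρ.KeywordSub ρ') {r : Ref}
    {v : Value} {t : RefTime} : EvalRef ts ρ ℓ r v t → EvalRef ts' ρ' ℓ r v t
  | .environment h => .environment (h.mono hρ)
  | .storage hx hnone => by
    cases hts with | untimed hs => exact .storage (hs.read hx) (by rw [hρ.var_eq, hnone])
  | .storagePre hx hnone => by
    cases hts with | timed hs _ => exact .storagePre (hs.read hx) (by rw [hρ.var_eq, hnone])
  | .storagePost hx hnone => by
    cases hts with | timed _ hs => exact .storagePost (hs.read hx) (by rw [hρ.var_eq, hnone])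
  | .calldata hx => by cases hts; exact .calldata (hρ.le hx)
  | .calldataTimed hx => by cases hts; exact .calldataTimed (hρ.le hx)
  | .coerce h => .coerce (h.mono hts hρ)
  | .field h hx => by
    have h' := h.mono hts hρ
    cases hts with | untimed hs => exact .field h' (hs.read hx)
  | .fieldPre h hx => by
    have h' := h.mono hts hρ
    cases hts with | timed hs _ => exact .fieldPre h' (hs.read hx)
  | .fieldPost h hx => by
    have h' := h.mono hts hρ
    cases hts with | timed _ hs => exact .fieldPost h' (hs.read hx)
  | .index (a := _) (f := _) h hr => .index (h.mono hts hρ) (hr.mono hts hρ)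
theorem EvalExp.mono {ts ts' : TState} (hts : ts.Sub ts') (hρ : ρ.KeywordSub ρ') {e : Exp}
    {v : Value} : EvalExp ts ρ ℓ e v → EvalExp ts' ρ' ℓ e v
  | .int => .int
  | .bool => .bool
  | .ref h => .ref (h.mono hts hρ)
  | .addr h => .addr (h.mono hts hρ)
  | .rangeTrue h hn => .rangeTrue (h.mono hts hρ) hn
  | .rangeFalse h hn => .rangeFalse (h.mono hts hρ) hn
  | .div h₁ h₂ h => .div (h₁.mono hts hρ) (h₂.mono hts hρ) h
  | .divZero h₁ h₂ h => .divZero (h₁.mono hts hρ) (h₂.mono hts hρ) h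
  | .mod h₁ h₂ h => .mod (h₁.mono hts hρ) (h₂.mono hts hρ) h
  | .modZero h₁ h₂ h => .modZero (h₁.mono hts hρ) (h₂.mono hts hρ) h
  | .bopI h₁ h₂ h hn => .bopI (h₁.mono hts hρ) (h₂.mono hts hρ) h hn
  | .bopB h₁ h₂ => .bopB (h₁.mono hts hρ) (h₂.mono hts hρ)
  | .neg h => .neg (h.mono hts hρ)
  | .cmp h₁ h₂ => .cmp (h₁.mono hts hρ) (h₂.mono hts hρ)
  | .iteTrue h₁ h₂ => .iteTrue (h₁.mono hts hρ) (h₂.mono hts hρ)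
  | .iteFalse h₁ h₃ => .iteFalse (h₁.mono hts hρ) (h₃.mono hts hρ)
  | .eqTrue h₁ h₂ h => .eqTrue (h₁.mono hts hρ) (h₂.mono hts hρ) h
  | .eqFalse h₁ h₂ h => .eqFalse (h₁.mono hts hρ) (h₂.mono hts hρ) h
end

end Mono

theorem EvalExp.mono_state {s s' : State} (hs : s.Sub s') {ρ : Env} {ℓ : Addr} {e : Exp}
    {v : Value} (h : EvalExp (.untimed s) ρ ℓ e v) : EvalExp (.untimed s') ρ ℓ e v :=
  h.mono (.untimed hs) (.refl ρ)

/-! ## Shallow typing -/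

/-- `s'` has an instance of the same contract wherever `s` has an object. -/
def State.TypeSub (s s' : State) : Prop :=
  ∀ ⦃ℓ o⦄, s ℓ = some o → ∃ o', s' ℓ = some o' ∧ o'.type = o.type

theorem State.TypeSub.refl (s : State) : s.TypeSub s := fun _ o ho => ⟨o, ho, rfl⟩

theorem State.TypeSub.trans {s₁ s₂ s₃ : State} (h : s₁.TypeSub s₂) (h' : s₂.TypeSub s₃) :
    s₁.TypeSub s₃ := by
  intro ℓ o ho
  obtain ⟨o₁, ho₁, htype₁⟩ := h ho
  obtain ⟨o₂, ho₂, htype₂⟩ := h' ho₁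
  exact ⟨o₂, ho₂, htype₂.trans htype₁⟩

theorem State.Sub.typeSub {s s' : State} (h : s.Sub s') : s.TypeSub s' :=
  fun _ o ho => ⟨o, h ho, rfl⟩

theorem State.TypeSub.update {s : State} {ℓ : Addr} {o : Obj}
    (h : ∀ o', s ℓ = some o' → o.type = o'.type) :
    s.TypeSub (Function.update s ℓ (some o)) := by
  intro ℓ' o' ho'
  rcases eq_or_ne ℓ' ℓ with rfl | hne
  · exact ⟨o, Function.update_self .., h o' ho'⟩
  · exact ⟨o', by rw [Function.update_of_ne hne, ho'], rfl⟩

/-- Typing of values that reads the contract name at an address, but not the store there. -/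
inductive HasShallowTy (s : State) : Value → SlotTy → Prop where
  | map {v μ} (h : HasMapTy v μ) : HasShallowTy s v (.map μ)
  | addressOf {ℓ o} (ho : s ℓ = some o) : HasShallowTy s (.base (.addr ℓ)) (.addressOf o.type)
  | contract {ℓ o} (ho : s ℓ = some o) : HasShallowTy s (.base (.addr ℓ)) (.contract o.type)

theorem HasShallowTy.mono {s s' : State} (hs : s.TypeSub s') {v : Value} {σ : SlotTy}
    (h : HasShallowTy s v σ) : HasShallowTy s' v σ := by
  cases h with
  | map h => exact .map h
  | addressOf ho => obtain ⟨o', ho', htype⟩ := hs ho; exact htype ▸ .addressOf ho'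
  | contract ho => obtain ⟨o', ho', htype⟩ := hs ho; exact htype ▸ .contract ho'

theorem HasSlotTy.hasShallowTy {S : Sig} {s : State} {v : Value} {σ : SlotTy}
    (h : HasSlotTy S s v σ) : HasShallowTy s v σ := by
  induction h with
  | map h => exact .map h
  | addrIsContract ho _ htype => exact htype ▸ .addressOf ho
  | contract _ ih => cases ih with | addressOf ho => exact .contract ho

/-- `A` has a constructor with at least one case. A constructor without cases has every storage
typing with a disjoint domain, so its typing says nothing about the storage typing of `A`. -/
def Sig.Creatable (S : Sig) (A : Ident) : Prop := ∃ c, S.cnstr A = some c ∧ c.cases ≠ []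

/-- `o` is an instance of a creatable contract with storage typing `C`, and its store conforms to
`C` up to the stores of other objects. -/
structure Obj.Conforms (o : Obj) (S : Sig) (s : State) (C : StorageTy) : Prop where
  creatable : S.Creatable o.type
  storage : S.storage o.type = some C
  dom : ∀ x, (o.store x).isSome ↔ ∃ σ, C x = some σ
  vals : ∀ x σ v, C x = some σ → o.store x = some v → HasShallowTy s v σ

theorem Obj.Conforms.mono {S : Sig} {s s' : State} (hs : s.TypeSub s') {o : Obj} {C : StorageTy}
    (h : o.Conforms S s C) : o.Conforms S s' C :=
  { h with vals := fun x σ v hσ hv => (h.vals x σ v hσ hv).mono hs }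

/-- The invariant of all steps: every object conforms to the storage typing of its contract. -/
def State.Conforms (s : State) (S : Sig) : Prop :=
  ∀ ⦃ℓ o⦄, s ℓ = some o → ∃ C, o.Conforms S s C

theorem State.Conforms.read {S : Sig} {s : State} (hs : s.Conforms S) {ℓ : Addr} {o : Obj}
    {C : StorageTy} {x : Ident} {σ : SlotTy} {v : Value} (ho : s ℓ = some o)
    (hC : S.storage o.type = some C) (hσ : C x = some σ) (hv : s.read ℓ x = some v) :
    HasShallowTy s v σ := by
  obtain ⟨C', h⟩ := hs ho
  cases hC.symm.trans h.storage
  exact h.vals x σ v hσ (by simpa only [State.read, ho, Option.bind_some] using hv)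

theorem State.Conforms.update {S : Sig} {s : State} (hs : s.Conforms S) {ℓ : Addr} {o : Obj}
    {C : StorageTy} (htype : ∀ o', s ℓ = some o' → o.type = o'.type) (ho : o.Conforms S s C) :
    State.Conforms (Function.update s ℓ (some o)) S := by
  have hsub := State.TypeSub.update htype
  intro ℓ' o' ho'
  rcases eq_or_ne ℓ' ℓ with rfl | hne
  · rw [Function.update_self] at ho'
    cases ho'
    exact ⟨C, ho.mono hsub⟩
  · rw [Function.update_of_ne hne] at ho'
    obtain ⟨C', h⟩ := hs ho'
    exact ⟨C', h.mono hsub⟩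

/-! ## From shallow typing to typing -/

theorem Sig.Sub.refl (S : Sig) : S.Sub S := ⟨fun _ _ h => h, fun _ _ h => h, fun _ _ h => h⟩

theorem Sig.Sub.trans {S₁ S₂ S₃ : Sig} (h : S₁.Sub S₂) (h' : S₂.Sub S₃) : S₁.Sub S₃ :=
  ⟨fun _ _ hC => h'.1 _ _ (h.1 _ _ hC), fun _ _ hc => h'.2.1 _ _ (h.2.1 _ _ hc),
    fun _ _ ht => h'.2.2 _ _ (h.2.2 _ _ ht)⟩

theorem HasSlotTy.mono {S S' : Sig} {s s' : State} (hS : S.Sub S') (hs : s.Sub s') {v : Value}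
    {σ : SlotTy} (h : HasSlotTy S s v σ) : HasSlotTy S' s' v σ := by
  induction h with
  | map h => exact .map h
  | addrIsContract ho hC htype hdom _ ih =>
    exact .addrIsContract (hs ho) (hS.1 _ _ hC) htype hdom ih
  | contract _ ih => exact .contract ih

theorem slotWf_contract_iff {S : Sig} {A : Ident} :
    SlotWf S (.contract A) ↔ (S.storage A).isSome := by
  refine ⟨fun h => ?_, .contract⟩
  generalize hσ : SlotTy.contract A = σ at h
  cases h with
  | contract h => cases hσ; exact h
  | @alpha α => cases α <;> cases hσ
  | map => cases hσ

theorem slotWf_addressOf_iff {S : Sig} {A : Ident} :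
    SlotWf S (.addressOf A) ↔ (S.storage A).isSome := by
  refine ⟨fun h => ?_, fun h => .alpha (α := .addressOf A) (.contractAddr ?_)⟩
  · generalize hσ : SlotTy.addressOf A = σ at h
    cases h with
    | contract | map => cases hσ
    | @alpha α h =>
      cases h with
      | int => cases hσ
      | contractAddr h => cases α <;> cases hσ; exact h A rfl
  · rintro _ ⟨⟩
    exact h

theorem HasSlotTy.slotWf {S : Sig} {s : State} {v : Value} {σ : SlotTy} (h : HasSlotTy S s v σ) :
    SlotWf S σ := by
  induction h with
  | map => exact .map
  | addrIsContract _ hC => exact slotWf_addressOf_iff.2 (Option.isSome_of_eq_some hC)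
  | contract _ ih => exact .contract (slotWf_addressOf_iff.1 ih)

section Lookup

variable {ι κ γ δ : Type*} [BEq κ] [LawfulBEq κ]

theorem lookup_zip_eq_getElem? {ks : List κ} {vs : List γ} (h : ks.length = vs.length) (x : κ) :
    (ks.zip vs).lookup x = vs[ks.idxOf x]? := by
  induction ks generalizing vs with
  | nil => cases vs <;> simp_all
  | cons k ks ih =>
    cases vs with
    | nil => simp at h
    | cons v vs =>
      by_cases hk : k = x
      · simp [hk]
      · have hk' : (x == k) = false := by simpa using Ne.symm hk
        simp [List.lookup_cons, hk', List.idxOf_cons_ne _ hk, ih (Nat.succ_injective h)]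

theorem lookup_map_eq_map_getElem? (l : List ι) (f : ι → κ) (g : ι → γ) (x : κ) :
    (l.map fun a => (f a, g a)).lookup x = l[(l.map f).idxOf x]?.map g := by
  rw [← List.zip_map', lookup_zip_eq_getElem? (by simp), List.getElem?_map]

theorem exists_mem_of_lookup_map_eq_some {l : List ι} {f : ι → κ} {g : ι → γ} {x : κ} {b : γ}
    (h : (l.map fun a => (f a, g a)).lookup x = some b) : ∃ a ∈ l, g a = b := by
  rw [lookup_map_eq_map_getElem?, Option.map_eq_some_iff] at h
  obtain ⟨a, ha, hb⟩ := h
  exact ⟨a, List.mem_of_getElem? ha, hb⟩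

theorem lookup_zip_ofFn_isSome_iff (l : List ι) (f : ι → κ) (g : ι → δ)
    (v : Fin l.length → γ) (x : κ) :
    (((l.map f).zip (List.ofFn v)).lookup x).isSome ↔
      ((l.map fun a => (f a, g a)).lookup x).isSome := by
  rw [lookup_zip_eq_getElem? (by simp), lookup_map_eq_map_getElem?]
  simp

theorem exists_of_lookup_zip_ofFn_eq_some {l : List ι} {f : ι → κ} {g : ι → δ}
    {v : Fin l.length → γ} {x : κ} {w : γ} {b : δ}
    (hw : ((l.map f).zip (List.ofFn v)).lookup x = some w)
    (hb : (l.map fun a => (f a, g a)).lookup x = some b) : ∃ i, v i = w ∧ g (l.get i) = b := by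
  rw [lookup_zip_eq_getElem? (by simp), List.getElem?_ofFn] at hw
  split_ifs at hw with hlt
  rw [lookup_map_eq_map_getElem?, List.getElem?_eq_getElem hlt, Option.map_some] at hb
  exact ⟨⟨_, hlt⟩, Option.some_injective _ hw, Option.some_injective _ hb⟩

end Lookup

theorem CtorHasTy.slotWf {S : Sig} {d : Addr} {A : Ident} {c : Ctor} {C : StorageTy}
    (h : CtorHasTy S d A c C) (hne : c.cases ≠ []) {x : Ident} {σ : SlotTy} (hσ : C x = some σ) :
    SlotWf S σ := by
  obtain ⟨k, hk⟩ := List.exists_mem_of_ne_nil _ hne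
  obtain ⟨hwf, rfl, -⟩ := h.creates k hk
  obtain ⟨cr, hcr, rfl⟩ := exists_mem_of_lookup_map_eq_some hσ
  exact hwf cr hcr

theorem WellTyped.hasSlotTy {d : Addr} {S S₁ : Sig} (hS : WellTyped d S₁) (hsub : S₁.Sub S)
    {s : State} (hs : s.Conforms S) {v : Value} {σ : SlotTy} (hv : HasShallowTy s v σ)
    (hσ : SlotWf S₁ σ) : HasSlotTy S₁ s v σ := by
  induction hS generalizing v σ with
  | @intro S₁ T _ dom cnstrSub _ cnstrTy _ _ _ ih _ =>
    have hobj : ∀ ⦃ℓ o⦄, s ℓ = some o → (S₁.storage o.type).isSome →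
        HasSlotTy S₁ s (.base (.addr ℓ)) (.addressOf o.type) := by
      intro ℓ o ho hdecl
      obtain ⟨C, h⟩ := hs ho
      obtain ⟨c, hc, hne⟩ := h.creatable
      have hcnstr := dom _ hdecl
      obtain ⟨c₁, hc₁⟩ := Option.isSome_iff_exists.1 hcnstr
      cases hc.symm.trans (hsub.2.1 _ _ hc₁)
      obtain ⟨C₁, hC₁, hty⟩ := cnstrTy _ _ hc₁
      cases h.storage.symm.trans (hsub.1 _ _ hC₁)
      refine .addrIsContract ho hC₁ rfl h.dom fun x σ v hσ hv => ?_
      have hT := (cnstrSub _ hcnstr).1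
      exact (ih _ hcnstr (hT.trans hsub) (h.vals x σ v hσ hv) (hty.slotWf hne hσ)).mono hT (.refl s)
    cases hv with
    | map h => exact .map h
    | addressOf ho => exact hobj ho (slotWf_addressOf_iff.1 hσ)
    | contract ho => exact .contract (hobj ho (slotWf_contract_iff.1 hσ))

/-! ## Expressions that do not change the state -/

/-- A configuration that is well-typed for `S₁` and whose state satisfies the invariant for a
larger signature `S`: code of a contract is typed in `S₁` but runs in `S`. -/
structure ConfigWf (S S₁ : Sig) (I : Iface) (A? : Option Ident) (s : State) (ρ : Env) (ℓ : Addr) :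
    Prop where
  sub : S₁.Sub S
  state : s.Conforms S
  env : HasEnvTy S₁ s ρ I
  loc : HasLocTy S₁ s ℓ A?

theorem Entails.hasMapTy {S : Sig} {I : Iface} {Φ e : Exp} {A? : Option Ident} {ι : IntTy}
    (h : Entails S I Φ A? (.inrange ι e)) {s : State} {ρ : Env} {ℓ : Addr} (hρ : HasEnvTy S s ρ I)
    (hℓ : HasLocTy S s ℓ A?) (hΦ : EvalExp (.untimed s) ρ ℓ Φ vTrue) {v : Value}
    (he : EvalExp (.untimed s) ρ ℓ e v) : HasMapTy v (.base (.int ι)) := by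
  obtain ⟨n, hn, hmem⟩ := (h s ρ ℓ hρ hℓ hΦ).mem_of_inrange
  rw [he.unique hn]
  exact .base (.int hmem)

theorem HasMapTy.unbounded {v : Value} {ι : IntTy} (h : HasMapTy v (.base (.int ι))) :
    HasMapTy v (.base (.int .unbounded)) := by
  cases h with | base h =>
  cases h
  exact .base (.int trivial)

theorem HasMapTy.apply {X : Kind} {f : X.Carrier → Value} {β : BaseTy} {μ : MapTy}
    (h : HasMapTy (.fn X f) (.mapping β μ)) {a : X.Carrier} (ha : HasBaseTy (X.inj a) β) :
    HasMapTy (f a) μ := by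
  cases h with | mapping h => exact h a ha

theorem EnvHasTy.hasShallowTy {S : Sig} {I : Iface} {A? : Option Ident} {s : State} {ρ : Env}
    {ℓ : Addr} (hρ : HasEnvTy S s ρ I) (hℓ : HasLocTy S s ℓ A?) {k : EnvRef} {α : ABITy}
    (h : EnvHasTy A? k α) {b : BaseValue} (he : EvalEnv ρ ℓ k b) :
    HasShallowTy s (.base b) α.toSlot := by
  have keyword : ∀ {key β}, (∃ b, ρ key = some b ∧ HasBaseTy b β) → ρ key = some b →
      HasShallowTy s (.base b) (.map (.base β)) := by
    rintro key β ⟨b', hb', hβ⟩ hb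
    cases hb.symm.trans hb'
    exact .map (.base hβ)
  cases h with
  | caller => cases he with | caller hb => exact keyword hρ.caller hb
  | origin => cases he with | origin hb => exact keyword hρ.origin hb
  | callvalue => cases he with | callvalue hb => exact keyword hρ.callvalue hb
  | this => cases he; cases HasSlotTy.hasShallowTy hℓ with | contract ho => exact .addressOf ho

section

variable {S S₁ : Sig} {I : Iface} {s : State} {ρ : Env} {ℓ : Addr}

mutual
theorem RefHasTy.hasShallowTy {A? : Option Ident} (c : ConfigWf S S₁ I A? s ρ ℓ) {k : RefTag}
    {t : Timing} {r : Ref} {σ : SlotTy} : RefHasTy S₁ I k A? t r σ → t = .untimed → ∀ {v t'},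
      EvalRef (.untimed s) ρ ℓ r v t' → HasShallowTy s v σ
  | .calldata h, _, _, _, .calldata hb => (c.env.vars _ _ _ h hb).hasShallowTy
  | .calldata h, _, _, _, .storage _ hnone => by
    have := (c.env.dom _).2 (Option.isSome_of_eq_some h)
    simp [hnone] at this
  | .storage hC hσ _, _, _, _, .storage hv _ => by
    cases HasSlotTy.hasShallowTy c.loc with
    | contract ho => exact c.state.read ho (c.sub.1 _ _ hC) hσ hv
  | .storage _ _ hnone, _, _, _, .calldata hb => by
    have := (c.env.dom _).1 (Option.isSome_of_eq_some hb)
    simp [hnone] at this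
  | .storagePre .., ht, _, _, _ => nomatch ht
  | .storagePost .., ht, _, _, _ => nomatch ht
  | .coerce h, ht, _, _, .coerce he => by
    cases h.hasShallowTy c ht he with | addressOf ho => exact .contract ho
  | .upcast h, ht, _, _, he => by
    cases h.hasShallowTy c ht he with | addressOf => exact .map (.base .addr)
  | .field h hC hσ, ht, _, _, .field he hv => by
    cases h.hasShallowTy c ht he with
    | contract ho => exact c.state.read ho (c.sub.1 _ _ hC) hσ hv
  | .index hr he, ht, _, _, .index (X := _) (a := _) (f := _) ha hf => by
    cases hr.hasShallowTy c ht hf with | map hf =>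
    cases he.hasMapTy c ht .bool ha with | base ha =>
    exact .map (hf.apply ha)
  | .environment h, _, _, _, .environment he => h.hasShallowTy c.env c.loc he
theorem ExpHasTy.hasMapTy {A? : Option Ident} (c : ConfigWf S S₁ I A? s ρ ℓ) {Φ : Exp}
    {t : Timing} {e : Exp} {β : BaseTy} : ExpHasTy S₁ I Φ A? t e β → t = .untimed →
      EvalExp (.untimed s) ρ ℓ Φ vTrue → ∀ {v}, EvalExp (.untimed s) ρ ℓ e v → HasMapTy v (.base β)
  | .int h, _, _, _, .int => .base (.int h)
  | .bool, _, _, _, .bool => .base .bool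
  | .ref h, ht, _, _, .ref he => by cases h.hasShallowTy c ht he with | map h => exact h
  | .addr h, ht, _, _, .addr he => by
    cases h.hasShallowTy c ht he with | contract => exact .base .addr
  | .range _, _, _, _, he => by cases he <;> exact .base .bool
  | .bopI _ _ _ hr, ht, hΦ, _, he => (hr ht).hasMapTy c.env c.loc hΦ he
  | .numConv (ι₂ := ι₂) h hr, ht, hΦ, _, he => by
    by_cases hι : ι₂ = .unbounded
    · exact hι ▸ (h.hasMapTy c ht hΦ he).unbounded
    · exact (hr hι).hasMapTy c.env c.loc hΦ he
  | .bopB .., _, _, _, .bopB .. => .base .bool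
  | .neg .., _, _, _, .neg .. => .base .bool
  | .cmp .., _, _, _, .cmp .. => .base .bool
  | .ite _ h₂ _, ht, hΦ, _, .iteTrue _ he => h₂.hasMapTy c ht hΦ he
  | .ite _ _ h₃, ht, hΦ, _, .iteFalse _ he => h₃.hasMapTy c ht hΦ he
  | .eq .., _, _, _, he => by cases he <;> exact .base .bool
end

end

theorem IntTy.zero_mem : ∀ ι : IntTy, ι.Mem 0
  | .uint _ => ⟨le_rfl, sub_nonneg.2 (one_le_pow₀ one_le_two)⟩
  | .sint _ => ⟨neg_nonpos.2 (by positivity), sub_nonneg.2 (one_le_pow₀ one_le_two)⟩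
  | .unbounded => trivial

theorem MapTy.hasMapTy_default : ∀ μ : MapTy, HasMapTy μ.default μ
  | .base (.int ι) => .base (.int ι.zero_mem)
  | .base .bool => .base .bool
  | .base .address => .base .addr
  | .mapping _ μ => .mapping fun _ _ => μ.hasMapTy_default

theorem hasMapTy_overrideFn {X : Kind} {n : ℕ} {k : Fin n → X.Carrier} {u : Fin n → Value}
    {g : X.Carrier → Value} {μ : MapTy} {a : X.Carrier} (hu : ∀ i, HasMapTy (u i) μ)
    (hg : HasMapTy (g a) μ) : HasMapTy (overrideFn k u g a) μ := by
  unfold overrideFn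
  cases h : (List.ofFn fun i => (k i, u i)).lookup a with
  | none => exact hg
  | some w =>
    rw [List.ofFn_eq_map] at h
    obtain ⟨i, -, rfl⟩ := exists_mem_of_lookup_map_eq_some h
    exact hu i

theorem MapHasTy.hasMapTy {S S₁ : Sig} {I : Iface} {A? : Option Ident} {s : State} {ρ : Env}
    {ℓ : Addr} (c : ConfigWf S S₁ I A? s ρ ℓ) {Φ : Exp} (hΦ : EvalExp (.untimed s) ρ ℓ Φ vTrue)
    {m : MapExp} {μ : MapTy} (h : MapHasTy S₁ I Φ A? m μ) {v : Value} (he : EvalMap s ρ ℓ m v) :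
    HasMapTy v μ := by
  induction h generalizing v with
  | exp h => cases he with | exp he => exact h.hasMapTy c rfl hΦ he
  | lit _ _ ih =>
    cases he with | lit _ hu =>
    exact .mapping fun _ _ => hasMapTy_overrideFn (fun i => ih i (hu i)) (MapTy.hasMapTy_default _)
  | upd hr _ _ ih =>
    cases he with | upd hf _ hu =>
    cases hr.hasShallowTy c rfl hf with | map hf =>
    exact .mapping fun _ ha => hasMapTy_overrideFn (fun i => ih i (hu i)) (hf.apply ha)

/-! ## Slot expressions and constructors -/

theorem IsFresh.eq_none {s : State} {ℓ : Addr} (h : IsFresh s ℓ) : s ℓ = none := by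
  obtain ⟨m, hm, rfl⟩ := h
  by_contra hne
  exact Nat.not_succ_le_self m (hm.1 (Option.isSome_iff_ne_none.2 hne))

theorem State.Sub.update {s : State} {ℓ : Addr} (h : s ℓ = none) (o : Obj) :
    s.Sub (Function.update s ℓ (some o)) := by
  intro ℓ' o' ho'
  rw [Function.update_of_ne, ho']
  rintro rfl
  cases h.symm.trans ho'

theorem State.Sub.last {n : ℕ} {st : Fin (n + 1) → State}
    (h : ∀ i : Fin n, (st i.castSucc).Sub (st i.succ)) (i : Fin (n + 1)) :
    (st i).Sub (st (Fin.last n)) := by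
  induction i using Fin.reverseInduction with
  | last => exact .refl _
  | cast i ih => exact (h i).trans ih

section

variable {S : Sig} {d : Addr}

mutual
theorem EvalSlot.sub {s s₂ : State} {ρ : Env} {ℓ : Addr} {se : SlotExp} {v : Value} :
    EvalSlot S d s ρ ℓ se v s₂ → s.Sub s₂
  | .map _ => .refl _
  | .ref _ => .refl _
  | .addr h => h.sub
  | .new (st := _) _ _ _ hargs _ hcases =>
    (State.Sub.last (fun i => (hargs i).sub) 0).trans hcases.sub
  | .newPayable (st := _) _ _ _ hargs hvalue _ hcases =>
    (State.Sub.last (fun i => (hargs i).sub) 0).trans (hvalue.sub.trans hcases.sub)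
theorem EvalCreates.sub {s s₂ : State} {ρ : Env} {cs : List Create} {A : Ident} {ℓ : Addr} :
    EvalCreates S d s ρ cs A ℓ s₂ → s.Sub s₂
  | .intro (st := _) (v := _) hse hℓ =>
    (State.Sub.last (fun i => (hse i).sub) 0).trans (.update hℓ.eq_none _)
theorem EvalCtorCases.sub {s s₂ : State} {ρ : Env} {cases : List CtorCase} {A : Ident}
    {ℓ : Addr} : EvalCtorCases S d s ρ cases A ℓ s₂ → s.Sub s₂
  | .intro _ _ _ hc => hc.sub
end

variable {S₁ : Sig}

mutual
theorem EvalSlot.mono_sig (hS : S₁.Sub S) {s s₂ : State} {ρ : Env} {ℓ : Addr} {se : SlotExp}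
    {v : Value} : EvalSlot S₁ d s ρ ℓ se v s₂ → EvalSlot S d s ρ ℓ se v s₂
  | .map h => .map h
  | .ref h => .ref h
  | .addr h => .addr (h.mono_sig hS)
  | .new (st := _) hctor hpay hlen hargs ho hcases =>
    .new (hS.2.1 _ _ hctor) hpay hlen (fun i => (hargs i).mono_sig hS) ho (hcases.mono_sig hS)
  | .newPayable (st := _) hctor hpay hlen hargs hvalue ho hcases =>
    .newPayable (hS.2.1 _ _ hctor) hpay hlen (fun i => (hargs i).mono_sig hS)
      (hvalue.mono_sig hS) ho (hcases.mono_sig hS)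
theorem EvalCreates.mono_sig (hS : S₁.Sub S) {s s₂ : State} {ρ : Env} {cs : List Create}
    {A : Ident} {ℓ : Addr} : EvalCreates S₁ d s ρ cs A ℓ s₂ → EvalCreates S d s ρ cs A ℓ s₂
  | .intro (st := _) (v := _) hse hℓ => .intro (fun i => (hse i).mono_sig hS) hℓ
theorem EvalCtorCases.mono_sig (hS : S₁.Sub S) {s s₂ : State} {ρ : Env} {cases : List CtorCase}
    {A : Ident} {ℓ : Addr} :
    EvalCtorCases S₁ d s ρ cases A ℓ s₂ → EvalCtorCases S d s ρ cases A ℓ s₂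
  | .intro j hj hi hc => .intro j hj hi (hc.mono_sig hS)
end

end

theorem ConfigWf.mono {S S₁ : Sig} {I : Iface} {A? : Option Ident} {s s' : State} {ρ : Env}
    {ℓ : Addr} (c : ConfigWf S S₁ I A? s ρ ℓ) (hs : s.Sub s') (hs' : s'.Conforms S) :
    ConfigWf S S₁ I A? s' ρ ℓ where
  sub := c.sub
  state := hs'
  env := { c.env with vars := fun x α b hα hb => (c.env.vars x α b hα hb).mono (.refl S₁) hs }
  loc := match A?, c.loc with
    | none, _ => trivial
    | some _, h => HasSlotTy.mono (.refl S₁) hs h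

theorem WellTyped.exists_ctorHasTy {d : Addr} {S : Sig} (hS : WellTyped d S) {A : Ident}
    {c : Ctor} (hc : S.cnstr A = some c) :
    ∃ T C, T.Sub S ∧ WellTyped d T ∧ S.storage A = some C ∧ CtorHasTy T d A c C := by
  cases hS with | intro T _ _ cnstrSub cnstrWt cnstrTy _ _ _ =>
  obtain ⟨C, hC, hty⟩ := cnstrTy A c hc
  have hA := Option.isSome_of_eq_some hc
  exact ⟨T A, C, (cnstrSub A hA).1, cnstrWt A hA, hC, hty⟩

theorem Iface.ty_eq_lookup_map (I : Iface) (x : Ident) :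
    I.ty x = (I.map fun p => (p.1, p.2)).lookup x := by
  rw [Iface.ty, List.map_id']

theorem hasEnvTy_callEnv {S S₁ : Sig} {d : Addr} (hS : WellTyped d S₁) (hsub : S₁.Sub S)
    {s : State} (hs : s.Conforms S) {I : Iface} (hI : IfaceWf S₁ I)
    {b : Fin I.length → BaseValue} (hb : ∀ i, HasShallowTy s (.base (b i)) (I.get i).2.toSlot)
    {c o w : BaseValue} (hc : HasBaseTy c .address) (ho : HasBaseTy o .address)
    (hw : HasBaseTy w BaseTy.uint256) :
    HasEnvTy S₁ s (callEnv I.names (List.ofFn b) c o w) I where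
  dom x := by
    rw [I.ty_eq_lookup_map]
    exact lookup_zip_ofFn_isSome_iff I Prod.fst Prod.snd b x
  vars x α bv hα hbv := by
    rw [I.ty_eq_lookup_map] at hα
    obtain ⟨i, rfl, rfl⟩ := exists_of_lookup_zip_ofFn_eq_some hbv hα
    exact hS.hasSlotTy hsub hs (hb i) (.alpha (hI _ (List.get_mem I i)))
  caller := ⟨c, rfl, hc⟩
  origin := ⟨o, rfl, ho⟩
  callvalue := ⟨w, rfl, hw⟩

theorem hasBaseTy_zero_uint256 : HasBaseTy (.int 0) BaseTy.uint256 := .int (IntTy.zero_mem _)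

theorem State.Conforms.create {S : Sig} {s : State} (hs : s.Conforms S) {ℓ : Addr}
    (hℓ : s ℓ = none) {A : Ident} (hA : S.Creatable A) {cs : List Create}
    (hC : S.storage A = some (storageOf cs)) {v : Fin cs.length → Value}
    (hv : ∀ i, HasShallowTy s (v i) (cs.get i).ty) :
    State.Conforms (Function.update s ℓ
      (some ⟨A, fun x => ((cs.map Create.name).zip (List.ofFn v)).lookup x⟩)) S := by
  refine hs.update (fun _ ho => nomatch hℓ.symm.trans ho)
    ⟨hA, hC, fun x => ?_, fun x σ w hσ hw => ?_⟩
  · rw [← Option.isSome_iff_exists]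
    exact lookup_zip_ofFn_isSome_iff cs Create.name Create.ty v x
  · obtain ⟨i, rfl, rfl⟩ := exists_of_lookup_zip_ofFn_eq_some hw hσ
    exact hv i

/-- Preservation for an evaluation of `se` in `S`: a typing of `se` in a smaller signature `S₁`
types its value. The evaluation is also one in `S₁`, so that the entailments in the typing, which
are about evaluations in `S₁`, apply to it. -/
def SlotPreserves (S : Sig) (d : Addr) (s : State) (ρ : Env) (ℓ : Addr) (se : SlotExp) (v : Value)
    (s₂ : State) : Prop :=
  ∀ ⦃S₁ I Φ A? σ⦄, WellTyped d S₁ → ConfigWf S S₁ I A? s ρ ℓ → EvalExp (.untimed s) ρ ℓ Φ vTrue →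
    SlotHasTy S₁ d I Φ A? se σ →
    s₂.Conforms S ∧ HasShallowTy s₂ v σ ∧ EvalSlot S₁ d s ρ ℓ se v s₂

/-- The analogue of `SlotPreserves` for a list of creates, typed by the storage typing of `A`. -/
def CreatesPreserve (S : Sig) (d : Addr) (s : State) (ρ : Env) (cs : List Create) (A : Ident)
    (ℓ : Addr) (s₂ : State) : Prop :=
  ∀ ⦃S₁ I Φ C⦄, WellTyped d S₁ → ConfigWf S S₁ I none s ρ d → EvalExp (.untimed s) ρ d Φ vTrue →
    CreatesHasTy S₁ d I Φ cs C → S.storage A = some C → S.Creatable A →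
    s₂.Conforms S ∧ HasShallowTy s₂ (.base (.addr ℓ)) (.contract A) ∧
      EvalCreates S₁ d s ρ cs A ℓ s₂

/-- The analogue of `SlotPreserves` for the cases of the constructor of `A`. -/
def CtorCasesPreserve (S : Sig) (d : Addr) (s : State) (ρ : Env) (cases : List CtorCase)
    (A : Ident) (ℓ : Addr) (s₂ : State) : Prop :=
  ∀ ⦃S₁ c C⦄, c.cases = cases → WellTyped d S₁ → CtorHasTy S₁ d A c C → S.storage A = some C →
    S.cnstr A = some c → ConfigWf S S₁ c.iface none s ρ d →
    (∀ p ∈ c.iffs, EvalExp (.untimed s) ρ d p vTrue) →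
    s₂.Conforms S ∧ HasShallowTy s₂ (.base (.addr ℓ)) (.contract A) ∧
      EvalCtorCases S₁ d s ρ cases A ℓ s₂

section Preservation

variable {S S₁ : Sig} {d : Addr} {I : Iface} {Φ : Exp} {A? : Option Ident} {ρ : Env} {ℓ : Addr}

theorem SlotPreserves.sequence {n : ℕ} {st : Fin (n + 1) → State} {se : Fin n → SlotExp}
    {v : Fin n → Value} {σ : Fin n → SlotTy}
    (heval : ∀ i, EvalSlot S d (st i.castSucc) ρ ℓ (se i) (v i) (st i.succ))
    (hpres : ∀ i, SlotPreserves S d (st i.castSucc) ρ ℓ (se i) (v i) (st i.succ))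
    (hS : WellTyped d S₁) (c : ConfigWf S S₁ I A? (st 0) ρ ℓ)
    (hΦ : EvalExp (.untimed (st 0)) ρ ℓ Φ vTrue) (hty : ∀ i, SlotHasTy S₁ d I Φ A? (se i) (σ i)) :
    ConfigWf S S₁ I A? (st (Fin.last n)) ρ ℓ ∧
      EvalExp (.untimed (st (Fin.last n))) ρ ℓ Φ vTrue ∧
      (∀ i, HasShallowTy (st (Fin.last n)) (v i) (σ i)) ∧
      ∀ i, EvalSlot S₁ d (st i.castSucc) ρ ℓ (se i) (v i) (st i.succ) := by
  have hsub := fun i => (heval i).sub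
  have hconfig : ∀ i, ConfigWf S S₁ I A? (st i) ρ ℓ ∧ EvalExp (.untimed (st i)) ρ ℓ Φ vTrue := by
    intro i
    induction i using Fin.induction with
    | zero => exact ⟨c, hΦ⟩
    | succ i ih =>
      exact ⟨ih.1.mono (hsub i) (hpres i hS ih.1 ih.2 (hty i)).1, ih.2.mono_state (hsub i)⟩
  have hstep := fun i => hpres i hS (hconfig _).1 (hconfig _).2 (hty i)
  exact ⟨(hconfig _).1, (hconfig _).2,
    fun i => (hstep i).2.1.mono (State.Sub.last hsub i.succ).typeSub, fun i => (hstep i).2.2⟩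

theorem SlotPreserves.map {s : State} {m : MapExp} {v : Value} (he : EvalMap s ρ ℓ m v) :
    SlotPreserves S d s ρ ℓ (.map m) v s
  | _, _, _, _, _, _, c, hΦ, .map hm => ⟨c.state, .map (hm.hasMapTy c hΦ he), .map he⟩

theorem SlotPreserves.ref {s : State} {r : Ref} {ann : Ident} {v : Value} {t : RefTime}
    (he : EvalRef (.untimed s) ρ ℓ r v t) : SlotPreserves S d s ρ ℓ (.ref r ann) v s
  | _, _, _, _, _, _, c, _, .ref hr => ⟨c.state, hr.hasShallowTy c rfl he, .ref he⟩

theorem SlotPreserves.addr {s s₂ : State} {se : SlotExp} {v : Value}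
    (h : SlotPreserves S d s ρ ℓ se v s₂) : SlotPreserves S d s ρ ℓ (.addr se) v s₂
  | _, _, _, _, _, hS, c, hΦ, .addr hse => by
    obtain ⟨hs₂, hv, he⟩ := h hS c hΦ hse
    cases hv with | contract ho => exact ⟨hs₂, .addressOf ho, .addr he⟩

theorem CtorCasesPreserve.call {s s₂ : State} {A : Ident} {c : Ctor}
    {b : Fin c.iface.length → BaseValue} {o w : BaseValue} {ℓ₁ : Addr}
    (h : CtorCasesPreserve S d s (callEnv c.iface.names (List.ofFn b) (.addr ℓ) o w) c.cases A ℓ₁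
      s₂)
    (hS : WellTyped d S₁) (hconf : ConfigWf S S₁ I A? s ρ ℓ) (hc : S₁.cnstr A = some c)
    (hb : ∀ i, HasShallowTy s (.base (b i)) (c.iface.get i).2.toSlot) (ho : ρ .origin = some o)
    (hw : HasBaseTy w BaseTy.uint256)
    (hiffs : ∀ p ∈ c.iffs,
      EvalExp (.untimed s) (bindArgs c.iface.names (List.ofFn b)) d p vTrue) :
    s₂.Conforms S ∧ HasShallowTy s₂ (.base (.addr ℓ₁)) (.contract A) ∧
      EvalCtorCases S₁ d s (callEnv c.iface.names (List.ofFn b) (.addr ℓ) o w) c.cases A ℓ₁ s₂ := by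
  obtain ⟨T, C, hTS₁, hT, hC, hty⟩ := hS.exists_ctorHasTy hc
  obtain ⟨o', ho', hoty⟩ := hconf.env.origin
  cases ho.symm.trans ho'
  have hTS := hTS₁.trans hconf.sub
  have henv := hasEnvTy_callEnv hT hTS hconf.state hty.wf hb (c := .addr ℓ) .addr hoty hw
  obtain ⟨hs₂, hℓ₁, he⟩ := h rfl hT hty (hconf.sub.1 _ _ hC) (hconf.sub.2.1 _ _ hc)
    ⟨hTS, hconf.state, henv, trivial⟩
    fun p hp => (hiffs p hp).mono (.untimed (.refl s)) (bindArgs_keywordSub ..)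
  exact ⟨hs₂, hℓ₁, he.mono_sig hTS₁⟩

variable {A : Ident} {n : ℕ} {args : Fin n → SlotExp} {ctor : Ctor} {o : BaseValue} {ℓ₁ : Addr}
  {s₂ : State} {st : Fin (n + 1) → State} {b : Fin n → BaseValue}

theorem SlotPreserves.new (hctor : S.cnstr A = some ctor)
    (hargs : ∀ i, EvalSlot S d (st i.castSucc) ρ ℓ (args i) (.base (b i)) (st i.succ))
    (hargs' : ∀ i, SlotPreserves S d (st i.castSucc) ρ ℓ (args i) (.base (b i)) (st i.succ))
    (ho : ρ .origin = some o)
    (hcases : CtorCasesPreserve S d (st (Fin.last n))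
      (callEnv ctor.iface.names (List.ofFn b) (.addr ℓ) o (.int 0)) ctor.cases A ℓ₁ s₂) :
    SlotPreserves S d (st 0) ρ ℓ (.new A n args) (.base (.addr ℓ₁)) s₂
  | _, _, _, _, _, hS, c, hΦ, .new hctor₁ hpay htys hiffs => by
    cases hctor.symm.trans (c.sub.2.1 _ _ hctor₁)
    obtain ⟨hlast, -, hb, hargs₁⟩ := SlotPreserves.sequence hargs hargs' hS c hΦ htys
    obtain ⟨hs₂, hℓ₁, hcases₁⟩ := hcases.call hS hlast hctor₁ hb ho hasBaseTy_zero_uint256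
      (hiffs st ρ ℓ b c.env c.loc hΦ hargs₁)
    exact ⟨hs₂, hℓ₁, .new hctor₁ hpay rfl hargs₁ ho hcases₁⟩

theorem SlotPreserves.newPayable {value : SlotExp} {w : BaseValue} {s₁ : State}
    (hctor : S.cnstr A = some ctor)
    (hargs : ∀ i, EvalSlot S d (st i.castSucc) ρ ℓ (args i) (.base (b i)) (st i.succ))
    (hargs' : ∀ i, SlotPreserves S d (st i.castSucc) ρ ℓ (args i) (.base (b i)) (st i.succ))
    (hvalue : EvalSlot S d (st (Fin.last n)) ρ ℓ value (.base w) s₁)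
    (hvalue' : SlotPreserves S d (st (Fin.last n)) ρ ℓ value (.base w) s₁)
    (ho : ρ .origin = some o)
    (hcases : CtorCasesPreserve S d s₁
      (callEnv ctor.iface.names (List.ofFn b) (.addr ℓ) o w) ctor.cases A ℓ₁ s₂) :
    SlotPreserves S d (st 0) ρ ℓ (.newPayable A value n args) (.base (.addr ℓ₁)) s₂
  | _, _, _, _, _, hS, c, hΦ, .newPayable hctor₁ hpay htys hvty hiffs => by
    cases hctor.symm.trans (c.sub.2.1 _ _ hctor₁)
    obtain ⟨hlast, hΦ', hb, hargs₁⟩ := SlotPreserves.sequence hargs hargs' hS c hΦ htys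
    obtain ⟨hs₁, hw, hvalue₁⟩ := hvalue' hS hlast hΦ' hvty
    cases hw with | map hw =>
    cases hw with | base hw =>
    obtain ⟨hs₂, hℓ₁, hcases₁⟩ := hcases.call hS (hlast.mono hvalue.sub hs₁) hctor₁
      (fun i => (hb i).mono hvalue.sub.typeSub) ho hw
      fun p hp => (hiffs st ρ ℓ b c.env c.loc hΦ hargs₁ p hp).mono_state hvalue.sub
    exact ⟨hs₂, hℓ₁, .newPayable hctor₁ hpay rfl hargs₁ hvalue₁ ho hcases₁⟩

theorem CreatesPreserve.intro {cs : List Create} {st : Fin (cs.length + 1) → State}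
    {v : Fin cs.length → Value}
    (hse : ∀ i, EvalSlot S d (st i.castSucc) ρ d (cs.get i).rhs (v i) (st i.succ))
    (hse' : ∀ i, SlotPreserves S d (st i.castSucc) ρ d (cs.get i).rhs (v i) (st i.succ))
    (hℓ : IsFresh (st (Fin.last cs.length)) ℓ) :
    CreatesPreserve S d (st 0) ρ cs A ℓ (Function.update (st (Fin.last cs.length)) ℓ
      (some ⟨A, fun x => ((cs.map Create.name).zip (List.ofFn v)).lookup x⟩)) := by
  rintro S₁ I Φ _ hS c hΦ ⟨-, rfl, -, hty⟩ hC hA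
  obtain ⟨hlast, -, hv, hse₁⟩ :=
    SlotPreserves.sequence hse hse' hS c hΦ fun i => hty _ (List.get_mem cs i)
  exact ⟨hlast.state.create hℓ.eq_none hA hC hv,
    .contract (o := ⟨A, _⟩) (Function.update_self ..), .intro hse₁ hℓ⟩

theorem CtorCasesPreserve.intro {s : State} {cases : List CtorCase} (j : Fin cases.length)
    (hj : EvalExp (.untimed s) ρ d (cases.get j).cond vTrue)
    (hi : ∀ i, i ≠ j → EvalExp (.untimed s) ρ d (cases.get i).cond vFalse)
    (hcr : CreatesPreserve S d s ρ (cases.get j).creates A ℓ s₂) :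
    CtorCasesPreserve S d s ρ cases A ℓ s₂ := by
  rintro S₁ c C rfl hS hty hC hc hconf hiffs
  have hmem := List.get_mem c.cases j
  obtain ⟨hs₂, hℓ, he⟩ := hcr hS hconf (.bopB hj (.bigAnd hiffs)) (hty.creates _ hmem) hC
    ⟨c, hc, List.ne_nil_of_mem hmem⟩
  exact ⟨hs₂, hℓ, .intro j hj hi he⟩

end Preservation

section

variable {S : Sig} {d : Addr}

mutual
theorem EvalSlot.preserves {s s₂ : State} {ρ : Env} {ℓ : Addr} {se : SlotExp} {v : Value} :
    EvalSlot S d s ρ ℓ se v s₂ → SlotPreserves S d s ρ ℓ se v s₂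
  | .map h => .map h
  | .ref h => .ref h
  | .addr h => .addr h.preserves
  | .new (st := _) hctor _ _ hargs ho hcases =>
    .new hctor hargs (fun i => (hargs i).preserves) ho hcases.preserves
  | .newPayable (st := _) hctor _ _ hargs hvalue ho hcases =>
    .newPayable hctor hargs (fun i => (hargs i).preserves) hvalue hvalue.preserves ho
      hcases.preserves
theorem EvalCreates.preserves {s s₂ : State} {ρ : Env} {cs : List Create} {A : Ident} {ℓ : Addr} :
    EvalCreates S d s ρ cs A ℓ s₂ → CreatesPreserve S d s ρ cs A ℓ s₂
  | .intro (st := _) (v := _) hse hℓ => .intro hse (fun i => (hse i).preserves) hℓ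
theorem EvalCtorCases.preserves {s s₂ : State} {ρ : Env} {cases : List CtorCase} {A : Ident}
    {ℓ : Addr} : EvalCtorCases S d s ρ cases A ℓ s₂ → CtorCasesPreserve S d s ρ cases A ℓ s₂
  | .intro j hj hi hc => .intro j hj hi hc.preserves
end

end

/-! ## Updates and steps -/

theorem State.Conforms.write {S : Sig} {s : State} (hs : s.Conforms S) {ℓ : Addr} {o : Obj}
    (ho : s ℓ = some o) {C : StorageTy} (hC : S.storage o.type = some C) {x : Ident} {σ : SlotTy}
    (hσ : C x = some σ) {v : Value} (hv : HasShallowTy s v σ) :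
    State.Conforms (Function.update s ℓ
      (some { o with store := Function.update o.store x (some v) })) S := by
  obtain ⟨C', h⟩ := hs ho
  cases hC.symm.trans h.storage
  refine hs.update (fun o' ho' => by cases ho.symm.trans ho'; rfl)
    ⟨h.creatable, hC, fun y => ?_, fun y τ w hτ hw => ?_⟩
  · rcases eq_or_ne y x with rfl | hne
    · simp only [Function.update_self, Option.isSome_some, hσ, Option.some.injEq, exists_eq']
    · simpa only [Function.update_of_ne hne] using h.dom y
  · rcases eq_or_ne y x with rfl | hne
    · cases hσ.symm.trans hτ
      cases (Function.update_self ..).symm.trans hw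
      exact hv
    · exact h.vals y τ w hτ ((Function.update_of_ne hne ..).symm.trans hw)

theorem Insert.typeSub {s s' : State} {ρ : Env} {ℓ : Addr} {r : Ref} {v : Value}
    (h : Insert ρ ℓ s r v s') : s.TypeSub s' := by
  cases h with
  | storage ho | field _ ho => exact .update fun o' ho' => by cases ho.symm.trans ho'; rfl

theorem Insert.conforms {S S₁ : Sig} {I : Iface} {A? : Option Ident} {s s' : State} {ρ : Env}
    {ℓ : Addr} {r : Ref} {v : Value} (h : Insert ρ ℓ s r v s') (c : ConfigWf S S₁ I A? s ρ ℓ)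
    {σ : SlotTy} (hr : RefHasTy S₁ I .storage A? .untimed r σ) (hv : HasShallowTy s v σ) :
    s'.Conforms S := by
  cases h with
  | storage ho =>
    cases hr with | storage hC hσ =>
    cases HasSlotTy.hasShallowTy c.loc with | contract ho' =>
    cases ho.symm.trans ho'
    exact c.state.write ho (c.sub.1 _ _ hC) hσ hv
  | field he ho =>
    cases hr with | field hr hC hσ =>
    cases hr.hasShallowTy c rfl he with | contract ho' =>
    cases ho.symm.trans ho'
    exact c.state.write ho (c.sub.1 _ _ hC) hσ hv

theorem ConfigWf.mono_typeSub {S S₁ : Sig} {d : Addr} (hS : WellTyped d S₁) {I : Iface}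
    {A? : Option Ident} {s s' : State} {ρ : Env} {ℓ : Addr} (c : ConfigWf S S₁ I A? s ρ ℓ)
    (hs : s.TypeSub s') (hs' : s'.Conforms S) : ConfigWf S S₁ I A? s' ρ ℓ := by
  have retype : ∀ {v σ}, HasSlotTy S₁ s v σ → HasSlotTy S₁ s' v σ := fun h =>
    hS.hasSlotTy c.sub hs' (h.hasShallowTy.mono hs) h.slotWf
  refine ⟨c.sub, hs', { c.env with vars := fun x α b hα hb => retype (c.env.vars x α b hα hb) }, ?_⟩
  cases A? with
  | none => trivial
  | some => exact retype c.loc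

theorem EvalUpdates.conforms {S S₁ : Sig} {d : Addr} {s s₂ : State} {ρ : Env} {ℓ : Addr}
    {us : List Update} (h : EvalUpdates S d s ρ ℓ us s₂) (hS : WellTyped d S₁) {I : Iface}
    {A : Ident} (c : ConfigWf S S₁ I (some A) s ρ ℓ) {Φ : Exp}
    (hΦ : EvalExp (.untimed s) ρ ℓ Φ vTrue) (hty : UpdatesWt S₁ d I Φ A us) : s₂.Conforms S := by
  obtain ⟨st, wr, v, rfl, hst, hwr, hins, rfl⟩ := h
  have hty' := fun i => hty.1 _ (List.get_mem us i)
  obtain ⟨hlast, -, hv, -⟩ :=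
    SlotPreserves.sequence hst (fun i => (hst i).preserves) hS c hΦ fun i => (hty' i).2
  rw [← hwr] at hlast hv
  have hwrite : ∀ i, ConfigWf S S₁ I (some A) (wr i) ρ ℓ ∧ (wr 0).TypeSub (wr i) := by
    intro i
    induction i using Fin.induction with
    | zero => exact ⟨hlast, .refl _⟩
    | succ i ih =>
      have hi := (hins i).conforms ih.1 (hty' i).1 ((hv i).mono ih.2)
      exact ⟨ih.1.mono_typeSub hS (hins i).typeSub hi, ih.2.trans (hins i).typeSub⟩
  exact (hwrite _).1.state

theorem EvalUpdates.eq_of_nil {S : Sig} {d : Addr} {s s₂ : State} {ρ : Env} {ℓ : Addr}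
    (h : EvalUpdates S d s ρ ℓ [] s₂) : s₂ = s := by
  obtain ⟨_, _, _, rfl, -, hwr, -, rfl⟩ := h
  exact hwr

theorem RefHasTy.storage_isSome {S : Sig} {I : Iface} {k : RefTag} {A? : Option Ident}
    {t : Timing} {r : Ref} {σ : SlotTy} :
    RefHasTy S I k A? t r σ → k = .storage → ∃ A, A? = some A ∧ (S.storage A).isSome
  | .storage hC _ _, _ => ⟨_, rfl, Option.isSome_of_eq_some hC⟩
  | .storagePre hC _ _, _ => ⟨_, rfl, Option.isSome_of_eq_some hC⟩
  | .storagePost hC _ _, _ => ⟨_, rfl, Option.isSome_of_eq_some hC⟩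
  | .field h _ _, hk => h.storage_isSome hk

theorem UpdatesWt.storage_isSome {S : Sig} {d : Addr} {I : Iface} {Φ : Exp} {A : Ident}
    {us : List Update} (h : UpdatesWt S d I Φ A us) (hne : us ≠ []) : (S.storage A).isSome := by
  obtain ⟨u, hu⟩ := List.exists_mem_of_ne_nil _ hne
  obtain ⟨_, ⟨⟩, hA⟩ := (h.1 u hu).1.storage_isSome rfl
  exact hA

theorem WellTyped.exists_transWt {d : Addr} {S : Sig} (hS : WellTyped d S) {A : Ident}
    {trs : List Trans} (htrs : S.trans A = some trs) :
    ∃ U, U.Sub S ∧ WellTyped d U ∧ ∀ tr ∈ trs, TransWt U d A tr := by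
  cases hS with | intro _ U _ _ _ _ transSub transWt transTy =>
  have hA := Option.isSome_of_eq_some htrs
  exact ⟨U A, (transSub A hA).1, transWt A hA, transTy A trs htrs⟩

theorem HasEnvTy.restrict {S S₁ : Sig} {s : State} {ρ : Env} {I : Iface} (h : HasEnvTy S s ρ I)
    {d : Addr} (hS : WellTyped d S₁) (hsub : S₁.Sub S) (hs : s.Conforms S) (hI : IfaceWf S₁ I) :
    HasEnvTy S₁ s ρ I :=
  { h with
    vars := fun x α b hα hb => by
      obtain ⟨p, hp, rfl⟩ := exists_mem_of_lookup_map_eq_some (I.ty_eq_lookup_map x ▸ hα)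
      exact hS.hasSlotTy hsub hs (h.vars x _ b hα hb).hasShallowTy (.alpha (hI p hp)) }

theorem StepCnstr.conforms {S : Sig} {d : Addr} {A : Ident} {ℓ : Addr} {s s₂ : State}
    (h : StepCnstr S d A ℓ s s₂) (hS : WellTyped d S) (hs : s.Conforms S) : s₂.Conforms S := by
  obtain ⟨ρ, c, hc, hρ, hiffs, hcases⟩ := h
  obtain ⟨T, C, hTS, hT, hC, hty⟩ := hS.exists_ctorHasTy hc
  have hconf : ConfigWf S T c.iface none s ρ d := ⟨hTS, hs, hρ.restrict hT hTS hs hty.wf, trivial⟩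
  exact (hcases.preserves rfl hT hty hC hc hconf hiffs).1

theorem StepTrans.conforms {S : Sig} {d : Addr} {A : Ident} {ℓ : Addr} {s s₂ : State}
    (h : StepTrans S d A ℓ s s₂) (hS : WellTyped d S) (hs : s.Conforms S) : s₂.Conforms S := by
  obtain ⟨ρ, trs, tr, w, hℓ, htrs, htr, hρ, hiffs, j, hj, -, hup, -⟩ := h
  obtain ⟨U, hUS, hU, htrsty⟩ := hS.exists_transWt htrs
  have hty := htrsty tr htr
  have hus := hty.updates _ (List.get_mem tr.cases j)
  -- If `U` does not declare `A`, then `ℓ` has no type in `U` and the entailments in the typing of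
  -- `tr` say nothing; but then there is no storage reference to update.
  rcases eq_or_ne (tr.cases.get j).updates [] with hnil | hne
  · rw [hnil] at hup
    exact hup.eq_of_nil ▸ hs
  · have hℓU := hU.hasSlotTy hUS hs hℓ.hasShallowTy (.contract (hus.storage_isSome hne))
    have hconf : ConfigWf S U tr.iface (some A) s ρ ℓ :=
      ⟨hUS, hs, hρ.restrict hU hUS hs hty.wf, hℓU⟩
    exact hup.conforms hU hconf (.bopB hj (.bigAnd hiffs)) hus

theorem Step.conforms {S : Sig} {d : Addr} {s s₂ : State} (h : Step S d s s₂)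
    (hS : WellTyped d S) (hs : s.Conforms S) : s₂.Conforms S := by
  rcases h with ⟨_, _, h⟩ | ⟨_, _, h⟩ <;> exact h.conforms hS hs

theorem Possible.conforms {S : Sig} {d : Addr} {s : State} (h : Possible S d s)
    (hS : WellTyped d S) : s.Conforms S := by
  induction h with
  | refl => exact fun _ _ ho => nomatch ho
  | tail _ hstep ih => exact hstep.conforms hS ih

end Act

theorem mainTheorem1 (d : Act.Addr) (S : Act.Sig) (hS : Act.WellTyped d S)
    (s : Act.State) (hs : Act.Possible S d s) (ℓ : Act.Addr) (hℓ : ℓ ∈ s.dom) :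
    ∃ A : Act.Ident, Act.HasSlotTy S s (.base (.addr ℓ)) (.contract A) := by
  have hwf := hs.conforms hS
  obtain ⟨o, ho⟩ := Option.isSome_iff_exists.1 hℓ
  obtain ⟨C, h⟩ := hwf ho
  have hA : Act.SlotWf S (.contract o.type) := .contract (Option.isSome_of_eq_some h.storage)
  exact ⟨o.type, hS.hasSlotTy (.refl S) hwf (.contract ho) hA⟩
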